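/- An acyclic directed mixed graph (ADMG) $G$ consists of a finite node set $V$, a set of directed edges $u \to v$ without directed cycles, and a set of bidirected edges $u \leftrightarrow v$ with $u \neq v$; write $p$ for the number of nodes and $m$ for the total number of edges. A node on a walk is a collider if both of its incident edges on the walk have an arrowhead at it; an interior node that is not a collider is a non-collider. A walk is open given $W \subseteq V$ if all its colliders are in $W$ and none of its non-colliders is in $W$. For pairwise disjoint $X, Y, W$, write $X \perp_G Y \mid W$ if there is no walk between $X$ and $Y$ that is open given $W$. For nodes $x \ne y$, let $\mathrm{causal}_G(x,y)$ be the set of descendants of $x$ from which there is a directed path to $y$ that does not contain $x$, and let $\mathrm{forb}_G(x,y)$ consist of $x$ and all descendants of nodes in $\mathrm{causal}_G(x,y)$ (a node counts as its own descendant, and paths may have length $0$). For pairwise disjoint $\{x,y\}$, $Z$, $W$ with $x \neq y$, the pair $(Z,W)$ is a valid conditional instrumental set relative to $(x,y)$ in $G$ if (i) $(Z \cup W) \cap \mathrm{forb}_G(x,y) = \emptyset$, (ii) $x \not\perp_G Z \mid W$, and (iii) $y \perp_{\tilde G} Z \mid W$, where $\tilde G$ is $G$ with all directed edges from $x$ to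 nodes in $\mathrm{causal}_G(x,y)$ removed. **Theorem.** There is an algorithm which, given an ADMG $G$ by adjacency lists (for every node, its children, its parents and its siblings) together with pairwise disjoint node sets $Z$, $\{x\}$ and $W$ of $G$, outputs the set of all nodes $y \in V \setminus (Z \cup W \cup \{x\})$ such that $(Z,W)$ is a valid conditional instrumental set relative to $(x,y)$ in $G$. The algorithm runs in time $O(p+m)$, that is, in linear time in the size of $G$, on a unit-cost random access machine with words of $O(\log(p+m+1))$ bits. -/

import Mathlib

/-! ## Acyclic directed mixed graphs, walks and d-separation -/

namespace CIS

/-- An acyclic directed mixed graph (ADMG) on the node set `V`: directed edges `u → v` (a set of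
ordered pairs without directed cycles, in particular without loops) and bidirected edges `u ↔ v`
(a set of two-element subsets of `V`). A pair of nodes may carry both kinds of edge. -/
structure ADMG (V : Type*) where
  /-- `dir u v` means `u → v`. -/
  dir : V → V → Prop
  /-- `bidir.Adj u v` means `u ↔ v`. -/
  bidir : SimpleGraph V
  /-- There is no directed cycle. -/
  acyclic : ∀ v, ¬ Relation.TransGen dir v v

/-- The ways in which an edge between `u` and `v` can be traversed from `u` to `v`. -/
inductive EdgeType
  /-- `u → v` -/
  | right
  /-- `u ← v` -/
  | left
  /-- `u ↔ v` -/
  | both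

/-- If a walk enters a node by an edge of type `s` and leaves it by an edge of type `t`, the node
is a collider at this place of the walk when both edges have an arrowhead at it. -/
def IsCollider (s t : EdgeType) : Prop :=
  (s = .right ∨ s = .both) ∧ (t = .left ∨ t = .both)

namespace ADMG

variable {V : Type*}

/-- `G.Edge t u v`: the graph has an edge of type `t` from `u` to `v`, i.e. `v` is a neighbour of
`u` of type `t` (child, parent, sibling for `right`, `left`, `both`). -/
def Edge (G : ADMG V) : EdgeType → V → V → Prop
  | .right, u, v => G.dir u v
  | .left, u, v => G.dir v u
  | .both, u, v => G.bidir.Adj u v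

/-- The number `m` of edges, directed and bidirected. -/
noncomputable def numEdges (G : ADMG V) : ℕ :=
  {e : V × V | G.dir e.1 e.2}.ncard + G.bidir.edgeSet.ncard

/-- Walks: sequences of edges; nodes and edges may be repeated. -/
inductive Walk (G : ADMG V) : V → V → Type _
  | nil (v : V) : Walk G v v
  | cons {u v w : V} (t : EdgeType) (h : G.Edge t u v) (q : Walk G v w) : Walk G u w

/-- `q.OpenAfter W s`: in the walk obtained by putting an edge of type `s` in front of `q`, every
interior node lies in `W` where it is a collider, and outside `W` where it is a non-collider. -/
def Walk.OpenAfter {G : ADMG V} (W : Set V) : {u v : V} → EdgeType → G.Walk u v → Prop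
  | _, _, _, .nil _ => True
  | u, _, s, .cons t _ q =>
      (IsCollider s t → u ∈ W) ∧ (¬ IsCollider s t → u ∉ W) ∧ q.OpenAfter W t

/-- A walk is open given `W` if all its colliders lie in `W` and none of its non-colliders does
(the endpoints are neither). -/
def Walk.IsOpen {G : ADMG V} (W : Set V) : {u v : V} → G.Walk u v → Prop
  | _, _, .nil _ => True
  | _, _, .cons t _ q => q.OpenAfter W t

/-- d-separation `X ⊥ Y | W`: no walk from `X` to `Y` is open given `W`. (Used for pairwise
disjoint `X`, `Y`, `W` only.) -/
def DSep (G : ADMG V) (X Y W : Set V) : Prop :=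
  ∀ a ∈ X, ∀ b ∈ Y, ∀ q : G.Walk a b, ¬ q.IsOpen W

/-- `de(X)`: the nodes to which a directed path (possibly of length `0`) leads from `X`. -/
def de (G : ADMG V) (X : Set V) : Set V :=
  {v | ∃ u ∈ X, Relation.ReflTransGen G.dir u v}

/-- `an_W(y)`: the nodes from which a directed path (possibly of length `0`) leads to `y` that
contains no node of `W`. -/
def anAvoiding (G : ADMG V) (W : Set V) (y : V) : Set V :=
  {u | u ∉ W ∧ Relation.ReflTransGen (fun a b => G.dir a b ∧ b ∉ W) u y}

/-- The causal nodes relative to `(x, y)`. -/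
def causal (G : ADMG V) (x y : V) : Set V :=
  G.anAvoiding {x} y ∩ G.de {x}

/-- The forbidden nodes relative to `(x, y)`. -/
def forb (G : ADMG V) (x y : V) : Set V :=
  G.de (G.causal x y) ∪ {x}

/-- The graph with all directed edges from `x` to nodes of `C` removed. -/
def removeEdges (G : ADMG V) (x : V) (C : Set V) : ADMG V where
  dir u v := G.dir u v ∧ ¬ (u = x ∧ v ∈ C)
  bidir := G.bidir
  acyclic v h := G.acyclic v (Relation.TransGen.mono (p := G.dir) (fun _ _ hab => hab.1) v v h)

/-- `(Z, W)` is a valid conditional instrumental set relative to `(x, y)` in `G`: the sets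
`{x, y}`, `Z`, `W` are pairwise disjoint (with `x ≠ y`) and the graphical validity criterion
holds. -/
structure IsValidCIS (G : ADMG V) (Z W : Set V) (x y : V) : Prop where
  ne : x ≠ y
  disjoint_Z : Disjoint {x, y} Z
  disjoint_W : Disjoint {x, y} W
  disjoint_ZW : Disjoint Z W
  /-- No node of `Z ∪ W` is forbidden. -/
  forb_inter : (Z ∪ W) ∩ G.forb x y = ∅
  /-- `x` and `Z` are d-connected given `W` in `G`. -/
  dconn : ¬ G.DSep {x} Z W
  /-- `y` and `Z` are d-separated given `W` once all directed edges from `x` to causal nodes are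
  removed. -/
  dsep : (G.removeEdges x (G.causal x y)).DSep {y} Z W

end ADMG

/-! ## Random access machines with a step count

Programs work on finitely many named registers and finitely many named arrays of words. They are
built from elementary instructions (copy, addition, truncated subtraction, reading and writing an
array cell at a computed index) by sequencing, branching and loops. Every elementary instruction
and every evaluation of a test takes one step. Words are natural numbers that are at most `N`; a
program that tries to write a larger number gets stuck. -/

/-- The contents of all registers and arrays. -/
structure Store where
  reg : ℕ → ℕ
  arr : ℕ → ℕ → ℕ

/-- A constant or the content of a register. -/
inductive Operand
  | const (k : ℕ)
  | reg (r : ℕ)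

/-- The value of an operand. -/
def Operand.eval (σ : Store) : Operand → ℕ
  | .const k => k
  | .reg r => σ.reg r

/-- Elementary expressions. -/
inductive Expr
  | copy (a : Operand)
  | add (a b : Operand)
  | sub (a b : Operand)
  /-- The cell with index `a` of the array number `A`. -/
  | load (A : ℕ) (a : Operand)

/-- The value of an elementary expression. -/
def Expr.eval (σ : Store) : Expr → ℕ
  | .copy a => a.eval σ
  | .add a b => a.eval σ + b.eval σ
  | .sub a b => a.eval σ - b.eval σ
  | .load A a => σ.arr A (a.eval σ)

/-- Tests. -/
inductive Test
  | eq (a b : Operand)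
  | lt (a b : Operand)

/-- The truth of a test. -/
def Test.Holds (σ : Store) : Test → Prop
  | .eq a b => a.eval σ = b.eval σ
  | .lt a b => a.eval σ < b.eval σ

/-- Programs. -/
inductive Prog
  | skip
  /-- Write the value of `e` to the register `r`. -/
  | assign (r : ℕ) (e : Expr)
  /-- Write `b` to the cell with index `a` of the array number `A`. -/
  | store (A : ℕ) (a b : Operand)
  | seq (P Q : Prog)
  | ite (b : Test) (P Q : Prog)
  | while (b : Test) (P : Prog)

/-- The store after writing `k` to register `r`. -/
def Store.setReg (σ : Store) (r k : ℕ) : Store :=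
  { σ with reg := Function.update σ.reg r k }

/-- The store after writing `k` to the cell `i` of array `A`. -/
def Store.setArr (σ : Store) (A i k : ℕ) : Store :=
  { σ with arr := Function.update σ.arr A (Function.update (σ.arr A) i k) }

/-- `Exec N P σ t τ`: on a machine whose words are the numbers up to `N`, the program `P` started
in `σ` halts after exactly `t` steps in `τ`. -/
inductive Exec (N : ℕ) : Prog → Store → ℕ → Store → Prop
  | skip (σ : Store) : Exec N .skip σ 1 σ
  | assign (σ : Store) (r : ℕ) (e : Expr) (h : e.eval σ ≤ N) :
      Exec N (.assign r e) σ 1 (σ.setReg r (e.eval σ))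
  | store (σ : Store) (A : ℕ) (a b : Operand) (ha : a.eval σ ≤ N) (hb : b.eval σ ≤ N) :
      Exec N (.store A a b) σ 1 (σ.setArr A (a.eval σ) (b.eval σ))
  | seq {P Q : Prog} {σ σ' τ : Store} {s t : ℕ} (hP : Exec N P σ s σ') (hQ : Exec N Q σ' t τ) :
      Exec N (.seq P Q) σ (s + t) τ
  | ite_true {b : Test} {P Q : Prog} {σ τ : Store} {t : ℕ} (hb : b.Holds σ)
      (hP : Exec N P σ t τ) : Exec N (.ite b P Q) σ (1 + t) τ
  | ite_false {b : Test} {P Q : Prog} {σ τ : Store} {t : ℕ} (hb : ¬ b.Holds σ)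
      (hQ : Exec N Q σ t τ) : Exec N (.ite b P Q) σ (1 + t) τ
  | while_true {b : Test} {P : Prog} {σ σ' τ : Store} {s t : ℕ} (hb : b.Holds σ)
      (hP : Exec N P σ s σ') (hW : Exec N (.while b P) σ' t τ) :
      Exec N (.while b P) σ (1 + s + t) τ
  | while_false {b : Test} {P : Prog} {σ : Store} (hb : ¬ b.Holds σ) :
      Exec N (.while b P) σ 1 σ

/-! ## Input and output -/

/-- An adjacency-list representation of an ADMG: for each node and each type, a list of the
neighbours of that type, in any order and without repetitions. -/
structure AdjLists {V : Type*} (G : ADMG V) where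
  nbrs : EdgeType → V → List V
  nodup : ∀ t v, (nbrs t v).Nodup
  mem_iff : ∀ t u v, v ∈ nbrs t u ↔ G.Edge t u v

/-- The array that holds the list `l`, followed by zeros. -/
def listArr (l : List ℕ) : ℕ → ℕ := fun i => l.getD i 0

/-- The array of a node set: cell `v` holds `1` if `v` is in the set, and `0` otherwise. -/
def setArr {p : ℕ} (S : Finset (Fin p)) : ℕ → ℕ :=
  listArr (List.ofFn fun v => if v ∈ S then 1 else 0)

/-- All adjacency lists of type `t`, concatenated in the order `0, …, p - 1` of the nodes. -/
def AdjLists.cells {p : ℕ} {G : ADMG (Fin p)} (L : AdjLists G) (t : EdgeType) : ℕ → ℕ :=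
  listArr ((List.ofFn (L.nbrs t)).flatten.map Fin.val)

/-- The array with the `p + 1` indices that delimit the adjacency lists of type `t` in
`L.cells t`: the list of node `v` fills the cells from `L.offsets t v` up to, but excluding,
`L.offsets t (v + 1)`. -/
def AdjLists.offsets {p : ℕ} {G : ADMG (Fin p)} (L : AdjLists G) (t : EdgeType) : ℕ → ℕ :=
  listArr ((List.range (p + 1)).map fun i => (((List.ofFn (L.nbrs t)).take i).map List.length).sum)

/-- The initial store. Registers `0` and `1` hold `p` and `x`; arrays `0` to `5` hold the
adjacency lists of children, parents and siblings, arrays `6` and `7` the sets `Z` and `W`.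
Everything else is zero. -/
def initStore {p : ℕ} {G : ADMG (Fin p)} (L : AdjLists G) (Z W : Finset (Fin p)) (x : Fin p) :
    Store where
  reg
    | 0 => p
    | 1 => x
    | _ => 0
  arr
    | 0 => L.offsets .right
    | 1 => L.cells .right
    | 2 => L.offsets .left
    | 3 => L.cells .left
    | 4 => L.offsets .both
    | 5 => L.cells .both
    | 6 => setArr Z
    | 7 => setArr W
    | _ => fun _ => 0

/-- The array in which a program leaves its result. -/
def outArr : ℕ := 8

/-- In the store `σ`, the output array is the array of the set `R` of nodes `0, …, p - 1`. -/
def Outputs {p : ℕ} (σ : Store) (R : Set (Fin p)) : Prop :=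
  ∀ y : Fin p, (y ∈ R → σ.arr outArr y = 1) ∧ (y ∉ R → σ.arr outArr y = 0)

end CIS

/-!
Fix `x`, `Z` and `W`. The set `causal x y`, and with it the forbidden set and the graph in which
separation is tested, depend on `y`, yet two graph searches suffice for all `y` together.

* By acyclicity, `causal x y` consists of the nodes `≠ x` on directed paths from `x` to `y`, so
  `Z ∪ W` meets `forb x y` if and only if `y` is a descendant of a child of `x` that is an ancestor
  of `Z ∪ W` (`ADMG.forb_inter_eq_empty_iff`; such `y` are called bad).
* If `y` is not bad, no causal child of `x` is an ancestor of `Z ∪ W`. Conversely, let `x → u` be an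
  edge whose head is not an ancestor of `Z ∪ W`. On an open walk between `y` and `Z` the part beyond
  `u`, in the direction of the edge, cannot contain a collider and cannot end in `Z`. So it is a
  directed path from `u` to `y`, and the edge is causal. Hence, for all `y` that are not bad, the
  graph without the causal edges has the same open walks between `y` and `Z` as the graph without
  the edges from `x` to nodes that are not ancestors of `Z ∪ W`, which does not depend on `y`
  (`ADMG.dSep_removeEdges_iff`).

Openness of walks is a local condition, so reachability by open walks is reachability in a graph on
pairs of a node and an edge mark (`ADMG.Step`). The edges `x → u` with `u` an ancestor of `Z ∪ W`
matter only if `x` itself is d-connected to `Z`, for otherwise no `y` is valid. So the program first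
searches without edges out of `x` (`ADMG.not_dSep_iff` reads off condition (ii) from the result);
if `x` is reached, it adds the heads of these edges as further starting points and goes on
searching. The criterion that the program evaluates in the end is `ADMG.isValidCIS_iff`.

For the running time, the search keeps a queue that only grows. Each of the `4 * p` states is
processed once, in time proportional to the degree of its node (`Runs.search`), which sums up to
`O(p + m)`. All numbers that occur are node numbers, positions in adjacency lists or queue lengths,
hence bounded by a multiple of `p + m`.
-/

/-! ### The search relation -/

namespace CIS

/-- The labels that the search attaches to nodes. A node gets the label `head` or `tail` when an
open walk leads from it to `Z` whose first edge has an arrowhead or a tail at the node (the walk of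
length `0` counts as `tail`), `anc` when it is an ancestor of `Z ∪ W`, and `bad` when it is a
descendant of a child of `x` that is an ancestor of `Z ∪ W`. -/
inductive Kind
  | head
  | tail
  | anc
  | bad
  deriving DecidableEq

instance : Fintype Kind := ⟨{.head, .tail, .anc, .bad}, fun k => by cases k <;> simp⟩

/-- The mark at `u` of an edge of type `t` from `u` to `v`. -/
def EdgeType.mark : EdgeType → Kind
  | .right => .tail
  | .left => .head
  | .both => .head

/-- A walk that enters `u` by an edge of type `s` and leaves it by an edge with mark `m` at `u` is
not blocked at `u`. -/
def Pass {V : Type*} (W : Set V) (s : EdgeType) (m : Kind) (u : V) : Prop :=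
  ((s = .right ∨ s = .both) ∧ m = .head → u ∈ W) ∧
    (¬ ((s = .right ∨ s = .both) ∧ m = .head) → u ∉ W)

namespace ADMG

variable {V : Type*}

/-- One step of the search. The walks to `Z` are built backwards from `Z`: an edge from `w` to `u`
is put in front of a walk that starts in `u`. Edges `x → w` are never used in this way. -/
inductive Step (G : ADMG V) (W : Set V) (x : V) : V × Kind → V × Kind → Prop
  | walk {s : EdgeType} {u w : V} {m : Kind} (hm : m = .head ∨ m = .tail) (he : G.Edge s w u)
      (hp : Pass W s m u) (hx : ¬ (s = .left ∧ u = x)) : Step G W x (u, m) (w, s.mark)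
  | anc {u w : V} (h : G.dir w u) : Step G W x (u, .anc) (w, .anc)
  | bad {u w : V} (h : G.dir u w) : Step G W x (u, .bad) (w, .bad)

/-- The states that the search reaches from the set `S`. -/
def Reach (G : ADMG V) (W : Set V) (x : V) (S : Set (V × Kind)) : Set (V × Kind) :=
  {s | ∃ a ∈ S, Relation.ReflTransGen (G.Step W x) a s}

/-- The states from which the search starts. -/
def seeds (Z W : Set V) : Set (V × Kind) :=
  {s | (s.2 = .anc ∧ (s.1 ∈ Z ∨ s.1 ∈ W)) ∨ (s.2 = .tail ∧ s.1 ∈ Z)}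

/-- The states added once `x` is known to be d-connected to `Z`: they account for the edges
`x → c` with `c` an ancestor of `Z ∪ W`. -/
def lateSeeds (G : ADMG V) (Z W : Set V) (x : V) : Set (V × Kind) :=
  {s | (s.2 = .bad ∨ s.2 = .head) ∧ G.dir x s.1 ∧ (s.1, Kind.anc) ∈ G.Reach W x (seeds Z W)}

variable {G : ADMG V} {Z W : Set V} {x : V} {S : Set (V × Kind)}

theorem Reach.of_mem {s : V × Kind} (h : s ∈ S) : s ∈ G.Reach W x S := ⟨s, h, .refl⟩

theorem Reach.step {s s' : V × Kind} (h : s ∈ G.Reach W x S) (hs : G.Step W x s s') :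
    s' ∈ G.Reach W x S := by
  obtain ⟨a, ha, h⟩ := h
  exact ⟨a, ha, h.tail hs⟩

theorem Reach.mono {S' : Set (V × Kind)} (h : S ⊆ S') : G.Reach W x S ⊆ G.Reach W x S' :=
  fun _ ⟨a, ha, hs⟩ => ⟨a, h ha, hs⟩

theorem Reach.subset_of_closed {I : Set (V × Kind)} (hS : S ⊆ I)
    (hI : ∀ s s', s ∈ I → G.Step W x s s' → s' ∈ I) : G.Reach W x S ⊆ I := by
  rintro s ⟨a, ha, h⟩
  induction h with
  | refl => exact hS ha
  | tail _ hs ih => exact hI _ _ ih hs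

/-! ### Ancestors of `Z ∪ W` and the forbidden nodes -/

/-- The ancestors of `Z ∪ W`. -/
def ancs (G : ADMG V) (Z W : Set V) : Set V :=
  {u | ∃ v, (v ∈ Z ∨ v ∈ W) ∧ Relation.ReflTransGen G.dir u v}

/-- The descendants of those children of `x` that are ancestors of `Z ∪ W`. -/
def bads (G : ADMG V) (Z W : Set V) (x : V) : Set V :=
  {y | ∃ c, G.dir x c ∧ c ∈ G.ancs Z W ∧ Relation.ReflTransGen G.dir c y}

theorem ancs_of_dir {u v : V} (h : G.dir u v) (hv : v ∈ G.ancs Z W) : u ∈ G.ancs Z W := by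
  obtain ⟨w, hw, hvw⟩ := hv
  exact ⟨w, hw, hvw.head h⟩

theorem mem_ancs_of_mem {u : V} (h : u ∈ Z ∨ u ∈ W) : u ∈ G.ancs Z W := ⟨u, h, .refl⟩

theorem anc_mem_reach_iff {u : V} :
    (u, Kind.anc) ∈ G.Reach W x (seeds Z W) ↔ u ∈ G.ancs Z W := by
  constructor
  · intro h
    have := Reach.subset_of_closed (G := G) (W := W) (x := x) (S := seeds Z W)
      (I := {s | s.2 = .anc → s.1 ∈ G.ancs Z W}) ?_ ?_ h
    · exact this rfl
    · rintro s (⟨_, h⟩ | ⟨h, _⟩) h'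
      · exact mem_ancs_of_mem h
      · rw [h] at h'; cases h'
    · intro s s' hs hst h'
      cases hst with
      | @walk s u w m => cases s <;> cases h'
      | anc h => exact ancs_of_dir h (hs rfl)
      | bad h => cases h'
  · rintro ⟨v, hv, huv⟩
    induction huv using Relation.ReflTransGen.head_induction_on with
    | refl => exact Reach.of_mem (Or.inl ⟨rfl, hv⟩)
    | head h _ ih => exact Reach.step ih (.anc h)

theorem bad_mem_reach_iff {y : V} :
    (y, Kind.bad) ∈ G.Reach W x (seeds Z W ∪ G.lateSeeds Z W x) ↔ y ∈ G.bads Z W x := by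
  constructor
  · intro h
    have := Reach.subset_of_closed (G := G) (W := W) (x := x)
      (S := seeds Z W ∪ G.lateSeeds Z W x)
      (I := {s | s.2 = .bad → s.1 ∈ G.bads Z W x}) ?_ ?_ h
    · exact this rfl
    · rintro s ((⟨h, _⟩ | ⟨h, _⟩) | ⟨_, hd, ha⟩) h'
      · rw [h] at h'; cases h'
      · rw [h] at h'; cases h'
      · exact ⟨_, hd, anc_mem_reach_iff.1 ha, .refl⟩
    · intro s s' hs hst h'
      cases hst with
      | @walk s u w m => cases s <;> cases h'
      | anc h => cases h'
      | bad h =>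
        obtain ⟨c, h1, h2, h3⟩ := hs rfl
        exact ⟨c, h1, h2, h3.tail h⟩
  · rintro ⟨c, h1, h2, h3⟩
    induction h3 with
    | refl => exact Reach.of_mem (Or.inr ⟨Or.inl rfl, h1, anc_mem_reach_iff.2 h2⟩)
    | tail _ h ih => exact Reach.step ih (.bad h)

/-- By acyclicity, a directed path that starts in a child of `x` avoids `x`. -/
theorem mem_causal_of_dir {c y : V} (hc : G.dir x c) (h : Relation.ReflTransGen G.dir c y) :
    c ∈ G.causal x y := by
  have hne : ∀ {v}, Relation.ReflTransGen G.dir c v → v ≠ x := by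
    rintro v hv rfl
    exact G.acyclic v (Relation.TransGen.head' hc hv)
  refine ⟨⟨hne .refl, ?_⟩, x, rfl, .single hc⟩
  induction h with
  | refl => exact .refl
  | tail h h' ih => exact ih.tail ⟨h', hne (h.tail h')⟩

theorem reflTransGen_of_mem_causal {c y : V} (h : c ∈ G.causal x y) :
    Relation.ReflTransGen G.dir c y :=
  Relation.ReflTransGen.mono (p := G.dir) (fun _ _ h => h.1) _ _ h.1.2

theorem forb_inter_eq_empty_iff {y : V} (hxZ : x ∉ Z) (hxW : x ∉ W) :
    (Z ∪ W) ∩ G.forb x y = ∅ ↔ y ∉ G.bads Z W x := by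
  rw [Set.eq_empty_iff_forall_notMem]
  constructor
  · rintro h ⟨c, hc, ⟨v, hv, hcv⟩, hcy⟩
    exact h v ⟨hv, Or.inl ⟨c, mem_causal_of_dir hc hcy, hcv⟩⟩
  · rintro h v ⟨hv, ⟨u, hu, huv⟩ | rfl⟩
    · obtain ⟨x', rfl, hxu⟩ := hu.2
      obtain rfl | ⟨c, hxc, hcu⟩ := hxu.cases_head
      · exact hu.1.1 rfl
      · exact h ⟨c, hxc, ⟨v, hv, hcu.trans huv⟩, hcu.trans (reflTransGen_of_mem_causal hu)⟩
    · exact hv.elim hxZ hxW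

/-! ### The labels `head` and `tail` and open walks -/

/-- What the label `m` of the node `u` certifies in the graph `H`. -/
def Certified (G H : ADMG V) (Z W : Set V) (s : V × Kind) : Prop :=
  (s.2 = .head ∨ s.2 = .tail → ∃ z ∈ Z, ∃ q : H.Walk s.1 z, q.IsOpen W ∧
    ∀ t, Pass W t s.2 s.1 → q.OpenAfter W t) ∧ (s.2 = .tail → s.1 ∈ G.ancs Z W)

theorem Pass.iff_cons {s t : EdgeType} {u : V} :
    Pass W s t.mark u ↔ (IsCollider s t → u ∈ W) ∧ (¬ IsCollider s t → u ∉ W) := by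
  cases s <;> cases t <;> simp [Pass, IsCollider, EdgeType.mark]

theorem certified_cons {H : ADMG V} {s : EdgeType} {u w : V} {m : Kind}
    (hm : m = .head ∨ m = .tail) (hu : G.Certified H Z W (u, m)) (he : H.Edge s w u)
    (hHG : ∀ a b, H.dir a b → G.dir a b) (hp : Pass W s m u) :
    G.Certified H Z W (w, s.mark) := by
  constructor
  · rintro -
    obtain ⟨z, hz, q, -, hq⟩ := hu.1 hm
    exact ⟨z, hz, .cons s he q, hq s hp, fun t ht =>
      ⟨(Pass.iff_cons.1 ht).1, (Pass.iff_cons.1 ht).2, hq s hp⟩⟩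
  · intro h
    cases s <;> simp only [EdgeType.mark, reduceCtorEq] at h
    refine ancs_of_dir (hHG _ _ he) ?_
    obtain rfl | rfl := hm
    · exact mem_ancs_of_mem (Or.inr (hp.1 ⟨Or.inl rfl, rfl⟩))
    · exact hu.2 rfl

/-- The hypotheses on `H` hold for `G` itself and for `G` without the edges from `x` to causal
nodes. An edge `x → u` that is traversed from `x` to `u` only occurs for `u` an ancestor of
`Z ∪ W`, because an open walk to `Z` that continues in `u` either goes on along a directed path or
has a collider in `u`. -/
theorem certified_of_mem_reach {H : ADMG V} (hb : H.bidir = G.bidir)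
    (hHG : ∀ a b, H.dir a b → G.dir a b)
    (hGH : ∀ a b, G.dir a b → (a = x → b ∈ G.ancs Z W) → H.dir a b)
    (hS : ∀ s ∈ S, G.Certified H Z W s) {s : V × Kind} (hs : s ∈ G.Reach W x S) :
    G.Certified H Z W s := by
  refine Reach.subset_of_closed (I := {s | G.Certified H Z W s}) hS ?_ hs
  intro s s' hc hst
  cases hst with
  | anc h => exact ⟨by simp, by simp⟩
  | bad h => exact ⟨by simp, by simp⟩
  | @walk s u w m hm he hp hx =>
    refine certified_cons hm hc ?_ hHG hp
    cases s with
    | right =>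
      refine hGH _ _ he fun _ => ?_
      obtain rfl | rfl := hm
      · exact mem_ancs_of_mem (Or.inr (hp.1 ⟨Or.inl rfl, rfl⟩))
      · exact hc.2 rfl
    | left => exact hGH _ _ he fun h => absurd ⟨rfl, h⟩ hx
    | both => simpa only [Edge, hb] using he

theorem certified_of_mem_seeds {H : ADMG V} {s : V × Kind}
    (hs : s ∈ seeds Z W) : G.Certified H Z W s := by
  obtain ⟨u, k⟩ := s
  obtain ⟨h, _⟩ | ⟨h, hz⟩ := hs
  · exact ⟨by simp_all, by simp_all⟩
  · exact ⟨fun _ => ⟨u, hz, .nil u, trivial, fun _ _ => trivial⟩,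
      fun _ => mem_ancs_of_mem (Or.inl hz)⟩

theorem pass_tail {t : EdgeType} {u : V} (h : u ∉ W) : Pass W t .tail u := by
  simp [Pass, h]

/-- An open walk from `u` to `Z` is found by the search, or it meets `x` and then its last part,
from `x` on, is found. -/
theorem exists_reach_of_openAfter (hZW : Disjoint Z W) {u z : V} (hz : z ∈ Z) (q : G.Walk u z) :
    ∀ s, q.OpenAfter W s →
      (∃ m, (m = .head ∨ m = .tail) ∧ (x, m) ∈ G.Reach W x (seeds Z W)) ∨
      ∃ m, (m = .head ∨ m = .tail) ∧ (u, m) ∈ G.Reach W x (seeds Z W) ∧ Pass W s m u := by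
  induction q with
  | nil v =>
    exact fun s _ => Or.inr ⟨.tail, Or.inr rfl, Reach.of_mem (Or.inr ⟨rfl, hz⟩),
      pass_tail (Set.disjoint_left.1 hZW hz)⟩
  | @cons u v w t he q ih =>
    rintro s ⟨h1, h2, h3⟩
    obtain h | ⟨m, hm, hr, hp⟩ := ih hz t h3
    · exact Or.inl h
    · -- Only a step out of `x` may be missing in the search, but then `x` itself is reached.
      by_cases hv : v = x
      · exact Or.inl ⟨m, hm, hv ▸ hr⟩
      · refine Or.inr ⟨t.mark, by cases t <;> simp [EdgeType.mark],
          Reach.step hr (.walk hm he hp fun h => hv h.2), Pass.iff_cons.2 ⟨h1, h2⟩⟩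

theorem openAfter_left_of_isOpen {H : ADMG V} {u z : V} (hu : u ∉ W) {q : H.Walk u z}
    (h : q.IsOpen W) : q.OpenAfter W .left := by
  cases q with
  | nil => trivial
  | cons t he q => exact ⟨by simp [IsCollider], fun _ => hu, h⟩

theorem not_dSep_iff (hZW : Disjoint Z W) (hxW : x ∉ W) :
    ¬ G.DSep {x} Z W ↔
      ∃ m, (m = .head ∨ m = .tail) ∧ (x, m) ∈ G.Reach W x (seeds Z W) := by
  constructor
  · intro h
    simp only [DSep, not_forall, not_not] at h
    obtain ⟨a, rfl, b, hb, q, hq⟩ := h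
    obtain h | ⟨m, hm, h, -⟩ :=
      exists_reach_of_openAfter hZW hb q _ (openAfter_left_of_isOpen hxW hq)
    · exact h
    · exact ⟨m, hm, h⟩
  · rintro ⟨m, hm, h⟩ hd
    obtain ⟨z, hz, q, hq, -⟩ := (certified_of_mem_reach (H := G) rfl (fun _ _ h => h)
      (fun _ _ h _ => h) (fun s hs => certified_of_mem_seeds hs) h).1 hm
    exact hd x rfl z hz q hq

/-- In the graph without the edges from `x` to causal nodes, open walks from `y` to `Z` are found
by the search: an edge `x → u` that is traversed from `u` to `x` has `u ∈ an(Z ∪ W)`, for otherwise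
the part of the walk between `y` and `u` would be a directed path from `u` to `y`. -/
theorem exists_reach_of_openAfter_removeEdges (hZW : Disjoint Z W)
    {y u z : V} (hz : z ∈ Z) (q : (G.removeEdges x (G.causal x y)).Walk u z) :
    ∀ s, q.OpenAfter W s →
      (s = .left → Relation.ReflTransGen G.dir u y ∨ u ∈ G.ancs Z W) →
      ∃ m, (m = .head ∨ m = .tail) ∧
        (u, m) ∈ G.Reach W x (seeds Z W ∪ G.lateSeeds Z W x) ∧ Pass W s m u := by
  induction q with
  | nil v =>
    exact fun s _ _ => ⟨.tail, Or.inr rfl, Reach.of_mem (Or.inl (Or.inr ⟨rfl, hz⟩)),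
      pass_tail (Set.disjoint_left.1 hZW hz)⟩
  | @cons u v w t he q ih =>
    rintro s ⟨h1, h2, h3⟩ hs
    -- Where the walk goes against an edge, it came from `y` by such edges only, or it had a
    -- collider, which is an ancestor of `W`.
    have hleft : t = .left → Relation.ReflTransGen G.dir u y ∨ u ∈ G.ancs Z W := by
      rintro rfl
      by_cases hl : s = .left
      · exact hs hl
      · exact Or.inr (mem_ancs_of_mem (Or.inr (h1 (by cases s <;> simp_all [IsCollider]))))
    have heG : G.Edge t u v := by
      cases t
      · exact he.1
      · exact he.1
      · exact he
    obtain ⟨m, hm, hr, hp⟩ := ih hz t h3 (by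
      rintro rfl
      exact (hleft rfl).imp (fun h => h.head heG) (fun h => ancs_of_dir heG h))
    refine ⟨t.mark, by cases t <;> simp [EdgeType.mark], ?_, Pass.iff_cons.2 ⟨h1, h2⟩⟩
    by_cases hv : t = .left ∧ v = x
    · -- The search does not take this step, but its target is a late seed.
      obtain ⟨rfl, rfl⟩ := hv
      refine Reach.of_mem (Or.inr ⟨Or.inr rfl, heG, anc_mem_reach_iff.2 ?_⟩)
      obtain h | h := hleft rfl
      · exact absurd ⟨rfl, mem_causal_of_dir heG h⟩ he.2
      · exact h
    · exact Reach.step hr (.walk hm heG hp hv)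

theorem dSep_removeEdges_iff (hZW : Disjoint Z W) (hxW : x ∉ W)
    (hx : ∃ m, (m = .head ∨ m = .tail) ∧ (x, m) ∈ G.Reach W x (seeds Z W))
    {y : V} (hyW : y ∉ W) (hy : y ∉ G.bads Z W x) :
    (G.removeEdges x (G.causal x y)).DSep {y} Z W ↔
      ∀ m, (m = .head ∨ m = .tail) →
        (y, m) ∉ G.Reach W x (seeds Z W ∪ G.lateSeeds Z W x) := by
  constructor
  · intro hd m hm h
    set H := G.removeEdges x (G.causal x y)
    have hHG : ∀ a b, H.dir a b → G.dir a b := fun a b h => h.1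
    have hGH : ∀ a b, G.dir a b → (a = x → b ∈ G.ancs Z W) → H.dir a b := by
      rintro a b hab h
      refine ⟨hab, ?_⟩
      rintro ⟨rfl, hb⟩
      exact hy ⟨b, hab, h rfl, reflTransGen_of_mem_causal hb⟩
    have hx' : ∃ m, (m = .head ∨ m = .tail) ∧ G.Certified H Z W (x, m) := by
      obtain ⟨m, hm, hr⟩ := hx
      exact ⟨m, hm, certified_of_mem_reach (G := G) (H := H) rfl hHG hGH
        (fun s hs => certified_of_mem_seeds hs) hr⟩
    have hS : ∀ s ∈ seeds Z W ∪ G.lateSeeds Z W x, G.Certified H Z W s := by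
      rintro ⟨c, k⟩ (hs | ⟨rfl | rfl, hd, ha⟩)
      · exact certified_of_mem_seeds hs
      · exact ⟨by simp, by simp⟩
      · obtain ⟨m, hm, hx⟩ := hx'
        exact certified_cons (s := .left) hm hx
          (hGH _ _ hd fun _ => anc_mem_reach_iff.1 ha) hHG (by simp [Pass, hxW])
    obtain ⟨z, hz, q, hq, -⟩ := (certified_of_mem_reach (G := G) (H := H) rfl hHG hGH hS h).1 hm
    exact hd y rfl z hz q hq
  · rintro h a rfl z hz q hq
    obtain ⟨m, hm, hr, -⟩ := exists_reach_of_openAfter_removeEdges hZW hz q .left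
      (openAfter_left_of_isOpen hyW hq) (fun _ => Or.inl .refl)
    exact h m hm hr

/-- The criterion that the program evaluates. -/
theorem isValidCIS_iff (hxZ : x ∉ Z) (hZW : Disjoint Z W) (hxW : x ∉ W) (y : V) :
    G.IsValidCIS Z W x y ↔
      (∃ m, (m = .head ∨ m = .tail) ∧ (x, m) ∈ G.Reach W x (seeds Z W)) ∧ y ∉ W ∧
        ∀ k, k ≠ .anc → (y, k) ∉ G.Reach W x (seeds Z W ∪ G.lateSeeds Z W x) := by
  constructor
  · rintro ⟨hne, hdZ, hdW, -, hf, hc, hs⟩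
    have hx := (not_dSep_iff hZW hxW).1 hc
    have hyW : y ∉ W := Set.disjoint_left.1 hdW (by simp)
    have hy := (forb_inter_eq_empty_iff hxZ hxW).1 hf
    have h := (dSep_removeEdges_iff hZW hxW hx hyW hy).1 hs
    refine ⟨hx, hyW, fun k hk => ?_⟩
    cases k
    · exact h _ (Or.inl rfl)
    · exact h _ (Or.inr rfl)
    · exact absurd rfl hk
    · exact fun h => hy (bad_mem_reach_iff.1 h)
  · rintro ⟨hx, hyW, h⟩
    have hy : y ∉ G.bads Z W x := fun hb => h .bad (by simp) (bad_mem_reach_iff.2 hb)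
    have hne : x ≠ y := by
      rintro rfl
      obtain ⟨m, hm, hr⟩ := hx
      exact h m (by rintro rfl; simp at hm) (Reach.mono Set.subset_union_left hr)
    have hyZ : y ∉ Z := fun hz =>
      h .tail (by simp) (Reach.of_mem (Or.inl (Or.inr ⟨rfl, hz⟩)))
    refine ⟨hne, ?_, ?_, hZW, (forb_inter_eq_empty_iff hxZ hxW).2 hy,
      (not_dSep_iff hZW hxW).2 hx, (dSep_removeEdges_iff hZW hxW hx hyW hy).2 ?_⟩
    · simp [hxZ, hyZ]
    · simp [hxW, hyW]
    · rintro m hm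
      exact h m (by rintro rfl; simp at hm)

end ADMG

end CIS

/-! ### Reasoning about runs -/

namespace CIS

/-- Started in `σ`, the program `P` halts after at most `T` steps in a store with the property
`Q`. -/
def Runs (N : ℕ) (P : Prog) (σ : Store) (T : ℕ) (Q : Store → Prop) : Prop :=
  ∃ t τ, Exec N P σ t τ ∧ t ≤ T ∧ Q τ

namespace Runs

variable {N T T' : ℕ} {P P' : Prog} {σ : Store} {Q Q' : Store → Prop}

theorem mono (h : Runs N P σ T Q) (hT : T ≤ T') (hQ : ∀ τ, Q τ → Q' τ) : Runs N P σ T' Q' := by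
  obtain ⟨t, τ, he, ht, hq⟩ := h
  exact ⟨t, τ, he, ht.trans hT, hQ τ hq⟩

theorem mono_time (h : Runs N P σ T Q) (hT : T ≤ T') : Runs N P σ T' Q := h.mono hT fun _ h => h

theorem skip (h : Q σ) : Runs N .skip σ 1 Q := ⟨1, σ, .skip σ, le_rfl, h⟩

theorem assign {r : ℕ} {e : Expr} (he : e.eval σ ≤ N) (h : Q (σ.setReg r (e.eval σ))) :
    Runs N (.assign r e) σ 1 Q := ⟨1, _, .assign σ r e he, le_rfl, h⟩

theorem store {A : ℕ} {a b : Operand} (ha : a.eval σ ≤ N) (hb : b.eval σ ≤ N)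
    (h : Q (σ.setArr A (a.eval σ) (b.eval σ))) : Runs N (.store A a b) σ 1 Q :=
  ⟨1, _, .store σ A a b ha hb, le_rfl, h⟩

theorem seq (h : Runs N P σ T fun τ => Runs N P' τ T' Q) : Runs N (.seq P P') σ (T + T') Q := by
  obtain ⟨t, τ, he, ht, t', τ', he', ht', hq⟩ := h
  exact ⟨t + t', τ', .seq he he', add_le_add ht ht', hq⟩

theorem seq_assign {r : ℕ} {e : Expr} (he : e.eval σ ≤ N)
    (h : Runs N P (σ.setReg r (e.eval σ)) T Q) : Runs N (.seq (.assign r e) P) σ (T + 1) Q :=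
  (seq (assign he h)).mono_time (by omega)

theorem seq_store {A : ℕ} {a b : Operand} (ha : a.eval σ ≤ N) (hb : b.eval σ ≤ N)
    (h : Runs N P (σ.setArr A (a.eval σ) (b.eval σ)) T Q) :
    Runs N (.seq (.store A a b) P) σ (T + 1) Q :=
  (seq (store ha hb h)).mono_time (by omega)

theorem ite {b : Test} (h : b.Holds σ → Runs N P σ T Q) (h' : ¬ b.Holds σ → Runs N P' σ T Q) :
    Runs N (.ite b P P') σ (T + 1) Q := by
  by_cases hb : b.Holds σ
  · obtain ⟨t, τ, he, ht, hq⟩ := h hb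
    exact ⟨1 + t, τ, .ite_true hb he, by omega, hq⟩
  · obtain ⟨t, τ, he, ht, hq⟩ := h' hb
    exact ⟨1 + t, τ, .ite_false hb he, by omega, hq⟩

/-- Amortized analysis of loops: `I n σ` is an invariant that contains the statement that the
remaining rounds take at most `n` steps. -/
theorem while_loop {b : Test} (I : ℕ → Store → Prop)
    (h : ∀ n σ, I n σ → b.Holds σ → ∃ T n', T + 1 + n' ≤ n ∧ Runs N P σ T (I n')) :
    ∀ n σ, I n σ → Runs N (.while b P) σ (n + 1) fun τ => ¬ b.Holds τ ∧ ∃ n', I n' τ := by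
  intro n
  induction n using Nat.strong_induction_on with
  | _ n ih =>
    intro σ hI
    by_cases hb : b.Holds σ
    · obtain ⟨T, n', hn, t, τ, he, ht, hI'⟩ := h n σ hI hb
      obtain ⟨t', τ', he', ht', hq⟩ := ih n' (by omega) τ hI'
      exact ⟨1 + t + t', τ', .while_true hb he he', by omega, hq⟩
    · exact ⟨1, σ, .while_false hb, by omega, hb, n, hI⟩

end Runs

section eval

variable {σ : Store}

@[simp] theorem eval_const (k : ℕ) : (Operand.const k).eval σ = k := rfl
@[simp] theorem eval_reg (r : ℕ) : (Operand.reg r).eval σ = σ.reg r := rfl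
@[simp] theorem eval_copy (a : Operand) : (Expr.copy a).eval σ = a.eval σ := rfl
@[simp] theorem eval_add (a b : Operand) : (Expr.add a b).eval σ = a.eval σ + b.eval σ := rfl
@[simp] theorem eval_load (A : ℕ) (a : Operand) : (Expr.load A a).eval σ = σ.arr A (a.eval σ) := rfl
@[simp] theorem holds_eq (a b : Operand) : (Test.eq a b).Holds σ ↔ a.eval σ = b.eval σ := Iff.rfl
@[simp] theorem holds_lt (a b : Operand) : (Test.lt a b).Holds σ ↔ a.eval σ < b.eval σ := Iff.rfl
@[simp] theorem setReg_arr (r k : ℕ) : (σ.setReg r k).arr = σ.arr := rfl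
@[simp] theorem setArr_reg (A i k : ℕ) : (σ.setArr A i k).reg = σ.reg := rfl

@[simp] theorem setReg_reg (r k s : ℕ) : (σ.setReg r k).reg s = if s = r then k else σ.reg s := by
  simp [Store.setReg, Function.update_apply]

@[simp] theorem setArr_arr (A i k B j : ℕ) :
    (σ.setArr A i k).arr B j = if B = A ∧ j = i then k else σ.arr B j := by
  by_cases h : B = A
  · subst h; simp [Store.setArr, Function.update_apply]
  · simp [Store.setArr, h]

end eval

/-! ### The input arrays -/

theorem setArr_apply {p : ℕ} (S : Finset (Fin p)) (v : Fin p) :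
    setArr S v = if v ∈ S then 1 else 0 := by
  simp [setArr, listArr, List.getD_eq_getElem?_getD]

namespace AdjLists

variable {p : ℕ} {G : ADMG (Fin p)} (L : AdjLists G) (t : EdgeType)

theorem offsets_apply {i : ℕ} (hi : i ≤ p) :
    L.offsets t i = (((List.ofFn (L.nbrs t)).take i).map List.length).sum := by
  have : i < p + 1 := by omega
  simp [offsets, listArr, List.getD_eq_getElem?_getD, this]

theorem offsets_succ (v : Fin p) :
    L.offsets t (v + 1) = L.offsets t v + (L.nbrs t v).length := by
  rw [offsets_apply _ _ v.2, offsets_apply _ _ v.2.le, List.take_add_one]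
  simp

theorem cells_apply (v : Fin p) {j : ℕ} (hj : j < (L.nbrs t v).length) :
    L.cells t (L.offsets t v + j) = (L.nbrs t v)[j] := by
  have hv : (v : ℕ) < (List.ofFn (L.nbrs t)).length := by simp
  have hl : (List.ofFn (L.nbrs t)) = (List.ofFn (L.nbrs t)).take v ++
      (L.nbrs t v :: (List.ofFn (L.nbrs t)).drop (v + 1)) := by
    conv_lhs => rw [← List.take_append_drop v (List.ofFn (L.nbrs t)),
      List.drop_eq_getElem_cons hv]
    simp
  rw [offsets_apply _ _ v.2.le, cells, listArr, ← List.length_flatten]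
  conv_lhs => enter [1, 2]; rw [hl]
  rw [List.flatten_append, List.flatten_cons, List.map_append, List.getD_append_right _ _ _ _
    (by rw [List.length_map]; omega), List.length_map, Nat.add_sub_cancel_left, List.map_append,
    List.getD_append _ _ _ _ (by simpa using hj)]
  simp [hj]

theorem sum_length_le : ∑ v, (L.nbrs t v).length ≤ 2 * G.numEdges := by
  classical
  have hlen : ∀ v, (L.nbrs t v).length = (Finset.univ.filter (G.Edge t v)).card := by
    intro v
    rw [← List.toFinset_card_of_nodup (L.nodup t v)]
    congr 1
    ext w
    simp [L.mem_iff]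
  have hdir : {e : Fin p × Fin p | G.dir e.1 e.2}.ncard =
      (Finset.univ.filter fun e : Fin p × Fin p => G.dir e.1 e.2).card := by
    rw [← Set.ncard_coe_finset]; simp
  have hr : ∑ v, (Finset.univ.filter (G.Edge .right v)).card =
      {e : Fin p × Fin p | G.dir e.1 e.2}.ncard := by
    rw [hdir, Finset.card_filter, Fintype.sum_prod_type]
    exact Finset.sum_congr rfl fun v _ => Finset.card_filter _ _
  simp only [hlen, ADMG.numEdges]
  cases t with
  | right => rw [hr]; omega
  | left =>
    have : ∑ v, (Finset.univ.filter (G.Edge .left v)).card =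
        ∑ v, (Finset.univ.filter (G.Edge .right v)).card := by
      simp only [Finset.card_filter, ADMG.Edge]
      exact Finset.sum_comm
    rw [this, hr]; omega
  | both =>
    have : ∑ v, (Finset.univ.filter (G.Edge .both v)).card = 2 * G.bidir.edgeSet.ncard := by
      rw [← SimpleGraph.coe_edgeFinset, Set.ncard_coe_finset,
        ← SimpleGraph.sum_degrees_eq_twice_card_edges]
      refine Finset.sum_congr rfl fun v _ => ?_
      rw [← SimpleGraph.card_neighborFinset_eq_degree]
      congr 1
      ext w
      simp [ADMG.Edge]
    rw [this]; omega

theorem offsets_le {i : ℕ} (hi : i ≤ p) : L.offsets t i ≤ 2 * G.numEdges := by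
  refine le_trans ?_ (L.sum_length_le t)
  rw [offsets_apply _ _ hi, ← List.sum_ofFn, show (List.ofFn fun v => (L.nbrs t v).length) =
    (List.ofFn (L.nbrs t)).map List.length by rw [List.map_ofFn]; rfl]
  exact ((List.take_sublist i _).map _).sum_le_sum (by simp)

end AdjLists

end CIS

/-! ### The building blocks of the program

Registers: `0` and `1` hold `p` and `x`, `2` the number of processed states, `3` the length of the
queue, `4` and `5` the node and the label of the state that is being processed, `6` and `7` the
current position and the end of an adjacency list, `8` the current node of a loop, and `9`
intermediate values. Arrays: `0` to `7` hold the input, `8` the output, `9` to `12` the marks of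
the four labels, `13` and `14` the queue.
-/

namespace CIS

/-- The number that represents a label. -/
def Kind.code : Kind → ℕ
  | .head => 0
  | .tail => 1
  | .anc => 2
  | .bad => 3

/-- The array in which the nodes with label `k` are marked. -/
def Kind.marks (k : Kind) : ℕ := 9 + k.code

/-- The array that holds the offsets of the adjacency lists of type `t`. -/
def EdgeType.offsetArr : EdgeType → ℕ
  | .right => 0
  | .left => 2
  | .both => 4

/-- The array that holds the adjacency lists of type `t`. -/
def EdgeType.cellArr : EdgeType → ℕ
  | .right => 1
  | .left => 3
  | .both => 5

/-- Give the node in register `8` the label `k`: unless it has this label already, mark it and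
append it to the queue, which is kept in the arrays `13` (nodes) and `14` (labels) and whose length
is in register `3`. -/
def push (k : Kind) : Prog :=
  .seq (.assign 9 (.load k.marks (.reg 8)))
    (.ite (.eq (.reg 9) (.const 0))
      (.seq (.store k.marks (.reg 8) (.const 1))
        (.seq (.store 13 (.reg 3) (.reg 8))
          (.seq (.store 14 (.reg 3) (.const k.code))
            (.assign 3 (.add (.reg 3) (.const 1))))))
      .skip)

/-- Run `P` once for every neighbour of type `t` of the node in register `4`, with the neighbour in
register `8`. -/
def scan (t : EdgeType) (P : Prog) : Prog :=
  .seq (.assign 6 (.load t.offsetArr (.reg 4)))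
    (.seq (.assign 9 (.add (.reg 4) (.const 1)))
      (.seq (.assign 7 (.load t.offsetArr (.reg 9)))
        (.while (.lt (.reg 6) (.reg 7))
          (.seq (.assign 8 (.load t.cellArr (.reg 6)))
            (.seq (.assign 6 (.add (.reg 6) (.const 1))) P)))))

/-- Run `P` once for every node, with the node in register `8`. -/
def forNodes (P : Prog) : Prog :=
  .seq (.assign 8 (.copy (.const 0)))
    (.while (.lt (.reg 8) (.reg 0)) (.seq P (.assign 8 (.add (.reg 8) (.const 1)))))

variable {p : ℕ} {G : ADMG (Fin p)}

/-- The store `σ` holds the unchanged input, an empty output, and the queue `l` of labelled nodes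
with the corresponding marks. -/
structure Holds (L : AdjLists G) (Z W : Finset (Fin p)) (x : Fin p) (σ : Store)
    (l : List (Fin p × Kind)) : Prop where
  reg_zero : σ.reg 0 = p
  reg_one : σ.reg 1 = x
  input : ∀ A < 8, σ.arr A = (initStore L Z W x).arr A
  output : ∀ i, σ.arr outArr i = 0
  mark : ∀ k (v : Fin p), σ.arr k.marks v = if (v, k) ∈ l then 1 else 0
  node : ∀ i (h : i < l.length), σ.arr 13 i = l[i].1
  kind : ∀ i (h : i < l.length), σ.arr 14 i = l[i].2.code
  length : σ.reg 3 = l.length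
  nodup : l.Nodup

/-- The list `l'` extends `l` exactly by the elements of `S`. -/
def Extends {α : Type*} (l l' : List α) (S : Set α) : Prop :=
  l <+: l' ∧ ∀ s, s ∈ l' ↔ s ∈ l ∨ s ∈ S

theorem Extends.refl {α : Type*} (l : List α) : Extends l l ∅ := ⟨List.prefix_rfl, by simp⟩

theorem Extends.trans {α : Type*} {l l' l'' : List α} {S S' : Set α} (h : Extends l l' S)
    (h' : Extends l' l'' S') : Extends l l'' (S ∪ S') :=
  ⟨h.1.trans h'.1, fun s => by rw [h'.2, h.2, Set.mem_union, or_assoc]⟩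

theorem Extends.congr {α : Type*} {l l' : List α} {S S' : Set α} (h : Extends l l' S)
    (hS : ∀ s, s ∈ S ↔ s ∈ S') : Extends l l' S' :=
  ⟨h.1, fun s => by rw [h.2, hS]⟩

variable {L : AdjLists G} {Z W : Finset (Fin p)} {x : Fin p} {N : ℕ}

namespace Holds

variable {σ : Store} {l : List (Fin p × Kind)}

theorem setReg (h : Holds L Z W x σ l) {r k : ℕ} (h0 : r ≠ 0) (h1 : r ≠ 1) (h3 : r ≠ 3) :
    Holds L Z W x (σ.setReg r k) l where
  reg_zero := by simp [h0.symm, h.reg_zero]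
  reg_one := by simp [h1.symm, h.reg_one]
  input := h.input
  output := h.output
  mark := h.mark
  node := h.node
  kind := h.kind
  length := by simp [h3.symm, h.length]
  nodup := h.nodup

theorem length_le (h : Holds L Z W x σ l) : l.length ≤ 4 * p := by
  have := h.nodup.length_le_card
  rw [Fintype.card_prod, Fintype.card_fin, show Fintype.card Kind = 4 from rfl] at this
  omega

theorem offsets (h : Holds L Z W x σ l) (t : EdgeType) : σ.arr t.offsetArr = L.offsets t := by
  cases t <;> exact h.input _ (by simp [EdgeType.offsetArr])

theorem cells (h : Holds L Z W x σ l) (t : EdgeType) : σ.arr t.cellArr = L.cells t := by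
  cases t <;> exact h.input _ (by simp [EdgeType.cellArr])

theorem arr_Z (h : Holds L Z W x σ l) (v : Fin p) : σ.arr 6 v = if v ∈ Z then 1 else 0 := by
  rw [h.input 6 (by simp)]; exact setArr_apply Z v

theorem arr_W (h : Holds L Z W x σ l) (v : Fin p) : σ.arr 7 v = if v ∈ W then 1 else 0 := by
  rw [h.input 7 (by simp)]; exact setArr_apply W v

theorem mark_le (h : Holds L Z W x σ l) (k : Kind) (v : Fin p) : σ.arr k.marks v ≤ 1 := by
  rw [h.mark]; split <;> omega

theorem push (h : Holds L Z W x σ l) {u : Fin p} {k : Kind} (hu : (u, k) ∉ l) :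
    Holds L Z W x ((((σ.setArr k.marks u 1).setArr 13 l.length u).setArr 14 l.length k.code).setReg
      3 (l.length + 1)) (l ++ [(u, k)]) where
  reg_zero := by simp [h.reg_zero]
  reg_one := by simp [h.reg_one]
  input A hA := by
    rw [← h.input A hA]
    funext i
    have : A ≠ k.marks := by unfold Kind.marks; omega
    simp [this, show A ≠ 13 by omega, show A ≠ 14 by omega]
  output i := by
    have : outArr ≠ k.marks := by unfold Kind.marks outArr; omega
    simp [this, h.output, show outArr ≠ 13 by decide, show outArr ≠ 14 by decide]
  mark k' v := by
    have := h.mark k' v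
    have h13 : k'.marks ≠ 13 := by cases k' <;> decide
    have h14 : k'.marks ≠ 14 := by cases k' <;> decide
    have hk : k'.marks = k.marks ↔ k' = k := by cases k <;> cases k' <;> decide
    by_cases hvu : v = u ∧ k' = k
    · obtain ⟨rfl, rfl⟩ := hvu
      simp [h13, h14]
    · have : ¬ (k' = k ∧ v = u) := fun h => hvu h.symm
      simp [h13, h14, hk, h.mark, Fin.val_inj, this, hvu]
  node i hi := by
    have h13 : 13 ≠ k.marks := by cases k <;> decide
    rw [List.length_append, List.length_singleton] at hi
    by_cases hl : i = l.length
    · subst hl; simp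
    · simp [h13, hl, h.node i (by omega), List.getElem_append_left (show i < l.length by omega)]
  kind i hi := by
    have h14 : 14 ≠ k.marks := by cases k <;> decide
    rw [List.length_append, List.length_singleton] at hi
    by_cases hl : i = l.length
    · subst hl; simp
    · simp [h14, hl, h.kind i (by omega), List.getElem_append_left (show i < l.length by omega)]
  length := by simp
  nodup := h.nodup.append (List.nodup_singleton _) (by simpa using hu)

end Holds

/-- With the node `u` in register `8`, the program `P` appends exactly the elements of `S u` to the
queue, in time `T`. It preserves the property `C` of the queue, and of the registers up to `8` it
changes only the length of the queue. -/
def Appends (L : AdjLists G) (Z W : Finset (Fin p)) (x : Fin p) (N : ℕ)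
    (C : List (Fin p × Kind) → Prop) (P : Prog) (T : ℕ) (S : Fin p → Set (Fin p × Kind)) : Prop :=
  ∀ σ l (u : Fin p), Holds L Z W x σ l → C l → σ.reg 8 = u →
    Runs N P σ T fun τ => ∃ l', Holds L Z W x τ l' ∧ C l' ∧ Extends l l' (S u) ∧
      ∀ r < 9, r ≠ 3 → τ.reg r = σ.reg r

section

variable {C : List (Fin p × Kind) → Prop} {P P' : Prog} {T T' : ℕ}
  {S S' : Fin p → Set (Fin p × Kind)}

theorem Appends.seq (h : Appends L Z W x N C P T S) (h' : Appends L Z W x N C P' T' S') :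
    Appends L Z W x N C (.seq P P') (T + T') fun u => S u ∪ S' u := by
  intro σ l u hσ hC hu
  refine Runs.seq ((h σ l u hσ hC hu).mono le_rfl ?_)
  rintro τ ⟨l', hτ, hC', he, hr⟩
  refine (h' τ l' u hτ hC' ((hr 8 (by omega) (by omega)).trans hu)).mono le_rfl ?_
  rintro τ' ⟨l'', hτ', hC'', he', hr'⟩
  exact ⟨l'', hτ', hC'', he.trans he', fun r h1 h2 => (hr' r h1 h2).trans (hr r h1 h2)⟩

/-- Run `P` if the cell of the array `A` for the node in register `8` is not `0`. -/
def ifMarked (A : ℕ) (P : Prog) : Prog :=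
  .seq (.assign 9 (.load A (.reg 8))) (.ite (.eq (.reg 9) (.const 0)) .skip P)

theorem Appends.ifMarked {A : ℕ} {B : Fin p → Prop} (hN : 1 ≤ N) (hT : 1 ≤ T)
    (hA : ∀ σ l, Holds L Z W x σ l → C l → ∀ u : Fin p,
      σ.arr A u ≤ 1 ∧ (σ.arr A u = 0 ↔ ¬ B u))
    (h : Appends L Z W x N C P T S) :
    Appends L Z W x N C (ifMarked A P) (T + 2) fun u => {s | B u ∧ s ∈ S u} := by
  intro σ l u hσ hC hu
  obtain ⟨h1, h0⟩ := hA σ l hσ hC u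
  refine Runs.seq_assign (by simp [hu]; omega) (Runs.ite (fun hb => ?_) fun hb => ?_)
  · have hB : ¬ B u := h0.1 (by simpa [hu] using hb)
    refine (Runs.skip ⟨l, hσ.setReg ?_ ?_ ?_, hC, (Extends.refl l).congr ?_, ?_⟩).mono_time hT
    · decide
    · decide
    · decide
    · simp [hB]
    · intro r hr _; simp [show r ≠ 9 by omega]
  · have hB : B u := by
      by_contra hB
      exact hb (by simpa [hu] using h0.2 hB)
    refine (h _ l u (hσ.setReg (by decide) (by decide) (by decide)) hC (by simp [hu])).mono
      le_rfl ?_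
    rintro τ ⟨l', hτ, hC', he, hr⟩
    refine ⟨l', hτ, hC', he.congr (by simp [hB]), fun r h1 h2 => ?_⟩
    rw [hr r h1 h2]; simp [show r ≠ 9 by omega]

theorem Appends.push {k : Kind} (hN : 4 * p + 2 * G.numEdges + 4 ≤ N)
    (hC : ∀ l u, C l → C (l ++ [(u, k)])) :
    Appends L Z W x N C (push k) 6 fun u => {(u, k)} := by
  intro σ l u hσ hCl hu
  have hm := hσ.mark_le k u
  refine Runs.seq_assign (T := 5) (by simp [hu]; omega)
    (Runs.ite (T := 4) (fun hb => ?_) fun hb => ?_)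
  · have hul : (u, k) ∉ l := by
      intro h
      have := hσ.mark k u
      simp_all
    have hle : (l ++ [(u, k)]).length ≤ 4 * p := by
      have := (hσ.push hul).length_le
      exact this
    rw [List.length_append, List.length_singleton] at hle
    have hk : k.code ≤ 3 := by cases k <;> decide
    have hup := u.2
    refine Runs.seq_store (by simp [hu]; omega) (by simp; omega) ?_
    refine Runs.seq_store (by simp [hσ.length]; omega) (by simp [hu]; omega) ?_
    refine Runs.seq_store (by simp [hσ.length]; omega) (by simp; omega) ?_
    refine Runs.assign (by simp [hσ.length]; omega) ?_
    refine ⟨l ++ [(u, k)], ?_, hC l u hCl, ⟨List.prefix_append _ _, by simp⟩, ?_⟩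
    · have := (hσ.setReg (r := 9) (k := σ.arr k.marks u) (by decide) (by decide)
        (by decide)).push hul
      simpa [hu, hσ.length] using this
    · intro r h1 h2
      simp [h2, show r ≠ 9 by omega]
  · have hul : (u, k) ∈ l := by
      by_contra h
      have := hσ.mark k u
      simp_all
    refine (Runs.skip ⟨l, hσ.setReg (by decide) (by decide) (by decide), hCl,
      ⟨List.prefix_rfl, ?_⟩, ?_⟩).mono_time (by omega)
    · rintro s
      simp only [Set.mem_singleton_iff, iff_self_or]
      rintro rfl; exact hul
    · intro r h1 h2
      simp [show r ≠ 9 by omega]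

theorem Runs.scan (h : Appends L Z W x N C P T S) (hN : 4 * p + 2 * G.numEdges + 4 ≤ N)
    {σ : Store} {l : List (Fin p × Kind)} {t : EdgeType} {v : Fin p}
    (hσ : Holds L Z W x σ l) (hC : C l) (hv : σ.reg 4 = v) :
    Runs N (scan t P) σ ((T + 3) * (L.nbrs t v).length + 4) fun τ =>
      ∃ l', Holds L Z W x τ l' ∧ C l' ∧ Extends l l' {s | ∃ u, G.Edge t v u ∧ s ∈ S u} ∧
        ∀ r < 6, r ≠ 3 → τ.reg r = σ.reg r := by
  have ho := L.offsets_le t (i := v) v.2.le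
  have ho' := L.offsets_le t (i := v + 1) v.2
  have hv2 := v.2
  refine Runs.seq_assign (by simp [hσ.offsets, hv]; omega) ?_
  refine Runs.seq_assign (by simp [hv]; omega) ?_
  refine Runs.seq_assign (by simp [hσ.offsets, hv]; omega) ?_
  set n := (L.nbrs t v).length with hn
  let I : ℕ → Store → Prop := fun m τ => ∃ j ≤ n, m = (T + 3) * (n - j) ∧
    τ.reg 6 = L.offsets t v + j ∧ τ.reg 7 = L.offsets t v + n ∧
    (∀ r < 6, r ≠ 3 → τ.reg r = σ.reg r) ∧
    ∃ l', Holds L Z W x τ l' ∧ C l' ∧ Extends l l' {s | ∃ u ∈ (L.nbrs t v).take j, s ∈ S u}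
  have hI : ∀ m τ, I m τ → (Test.lt (.reg 6) (.reg 7)).Holds τ → ∃ T' m', T' + 1 + m' ≤ m ∧
      Runs N (.seq (.assign 8 (.load t.cellArr (.reg 6)))
            (.seq (.assign 6 (.add (.reg 6) (.const 1))) P)) τ T' (I m') := by
    rintro m τ ⟨j, hj, rfl, h6, h7, hr, l', hτ, hCl', he⟩ hb
    have hjn : j < n := by simp [h6, h7] at hb; omega
    have hs := L.offsets_succ t v
    have hcell : τ.arr t.cellArr (τ.reg 6) = (L.nbrs t v)[j] := by
      rw [hτ.cells, h6, L.cells_apply t v hjn]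
    have hu2 := ((L.nbrs t v)[j]).2
    refine ⟨T + 2, (T + 3) * (n - (j + 1)), ?_, ?_⟩
    · rw [show n - j = (n - (j + 1)) + 1 by omega, mul_add]; omega
    refine Runs.seq_assign (T := T + 1) (by simp only [eval_load, eval_reg, hcell]; omega) ?_
    refine Runs.seq_assign (by simp [h6]; omega) ?_
    refine (h _ l' (L.nbrs t v)[j] ((hτ.setReg (by decide) (by decide) (by decide)).setReg
      (by decide) (by decide) (by decide)) hCl' (by simp [hcell])).mono le_rfl ?_
    rintro τ' ⟨l'', hτ', hCl'', he', hr'⟩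
    refine ⟨j + 1, hjn, rfl, ?_, ?_, ?_, l'', hτ', hCl'', (he.trans he').congr ?_⟩
    · rw [hr' 6 (by decide) (by decide)]; simp [h6]; omega
    · rw [hr' 7 (by decide) (by decide)]; simp [h7]
    · intro r h1 h2
      rw [hr' r (by omega) h2]
      simp [show r ≠ 6 by omega, show r ≠ 8 by omega, hr r h1 h2]
    · intro s
      simp only [Set.mem_union, Set.mem_ofPred_eq, List.take_add_one,
        List.getElem?_eq_getElem hjn, Option.toList_some, List.mem_append, List.mem_singleton,
        or_and_right, exists_or, exists_eq_left]
  refine (Runs.while_loop I hI ((T + 3) * n) _ ⟨0, by omega, rfl, ?_, ?_, ?_, l, ?_, hC, ?_⟩).mono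
    le_rfl ?_
  · simp [hσ.offsets, hv]
  · simp [hσ.offsets, hv, L.offsets_succ]; omega
  · intro r h1 h2
    simp [show r ≠ 6 by omega, show r ≠ 7 by omega, show r ≠ 9 by omega]
  · exact ((hσ.setReg (by decide) (by decide) (by decide)).setReg
      (by decide) (by decide) (by decide)).setReg (by decide) (by decide) (by decide)
  · exact (Extends.refl l).congr (by simp)
  · rintro τ ⟨hb, m, j, hj, rfl, h6, h7, hr, l', hτ, hCl', he⟩
    have hjn : j = n := by simp [h6, h7] at hb; omega
    refine ⟨l', hτ, hCl', he.congr ?_, hr⟩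
    intro s
    simp [hjn, hn, L.mem_iff]

theorem Runs.forNodes (J : ℕ → Store → Prop) (hN : p ≤ N)
    (hreg : ∀ j σ, J j σ → σ.reg 0 = p) (hset : ∀ j σ k, J j σ → J j (σ.setReg 8 k))
    (hP : ∀ j < p, ∀ σ, J j σ → σ.reg 8 = j →
      Runs N P σ T fun τ => J (j + 1) τ ∧ τ.reg 8 = j)
    {σ : Store} (hσ : J 0 σ) : Runs N (forNodes P) σ ((T + 2) * p + 2) (J p) := by
  refine Runs.seq_assign (by simp) ?_
  let I : ℕ → Store → Prop := fun m τ => ∃ j ≤ p, m = (T + 2) * (p - j) ∧ τ.reg 8 = j ∧ J j τ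
  have hI : ∀ m τ, I m τ → (Test.lt (.reg 8) (.reg 0)).Holds τ → ∃ T' m', T' + 1 + m' ≤ m ∧
      Runs N (.seq P (.assign 8 (.add (.reg 8) (.const 1)))) τ T' (I m') := by
    rintro m τ ⟨j, hj, rfl, h8, hτ⟩ hb
    have hjp : j < p := by simpa [h8, hreg j τ hτ] using hb
    refine ⟨T + 1, (T + 2) * (p - (j + 1)), ?_, ?_⟩
    · rw [show p - j = (p - (j + 1)) + 1 by omega, mul_add]; omega
    refine Runs.seq ((hP j hjp τ hτ h8).mono le_rfl ?_)
    rintro τ' ⟨hτ', h8'⟩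
    exact Runs.assign (by simp [h8']; omega) ⟨j + 1, hjp, rfl, by simp [h8'], hset _ _ _ hτ'⟩
  refine (Runs.while_loop I hI ((T + 2) * p) _ ⟨0, by omega, rfl, by simp, hset _ _ _ hσ⟩).mono
    le_rfl ?_
  rintro τ ⟨hb, m, j, hj, rfl, h8, hτ⟩
  have hjp : j = p := by simp [h8, hreg j τ hτ] at hb; omega
  exact hjp ▸ hτ

theorem Runs.forNodes_appends (h : Appends L Z W x N C P T S) (hN : p ≤ N)
    {σ : Store} {l : List (Fin p × Kind)} (hσ : Holds L Z W x σ l) (hC : C l) :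
    Runs N (CIS.forNodes P) σ ((T + 2) * p + 2) fun τ =>
      ∃ l', Holds L Z W x τ l' ∧ C l' ∧ Extends l l' {s | ∃ u, s ∈ S u} ∧
        ∀ r < 8, r ≠ 3 → τ.reg r = σ.reg r := by
  refine (Runs.forNodes (fun j τ => ∃ l', Holds L Z W x τ l' ∧ C l' ∧
    Extends l l' {s | ∃ u : Fin p, (u : ℕ) < j ∧ s ∈ S u} ∧
    ∀ r < 8, r ≠ 3 → τ.reg r = σ.reg r) hN ?_ ?_ ?_
    ⟨l, hσ, hC, (Extends.refl l).congr (by simp), fun _ _ _ => rfl⟩).mono le_rfl ?_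
  · rintro j τ ⟨l', hτ, -⟩
    exact hτ.reg_zero
  · rintro j τ k ⟨l', hτ, hC', he, hr⟩
    refine ⟨l', hτ.setReg (by decide) (by decide) (by decide), hC', he, fun r h1 h2 => ?_⟩
    simp [show r ≠ 8 by omega, hr r h1 h2]
  · rintro j hjp τ ⟨l', hτ, hC', he, hr⟩ h8
    refine (h τ l' ⟨j, hjp⟩ hτ hC' h8).mono le_rfl ?_
    rintro τ' ⟨l'', hτ', hC'', he', hr'⟩
    refine ⟨⟨l'', hτ', hC'', (he.trans he').congr fun s => ?_, fun r h1 h2 => ?_⟩,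
      (hr' 8 (by decide) (by decide)).trans h8⟩
    · constructor
      · rintro (⟨u, hu, hs⟩ | hs)
        · exact ⟨u, by omega, hs⟩
        · exact ⟨_, Nat.lt_succ_self j, hs⟩
      · rintro ⟨u, hu, hs⟩
        obtain hu | hu := Nat.lt_succ_iff_lt_or_eq.1 hu
        · exact Or.inl ⟨u, hu, hs⟩
        · subst hu; exact Or.inr hs
    · rw [hr' r (by omega) h2, hr r h1 h2]
  · rintro τ ⟨l', hτ, hC', he, hr⟩
    exact ⟨l', hτ, hC', he.congr (by simp), hr⟩

end

end CIS

/-! ### The search loop -/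

namespace CIS

/-- Append the successors of a state with label `head` or `tail`. The sum of the label's code (`0`
for `head`, `1` for `tail`) and of the bit that tells whether the node lies in `W` is `1` exactly if
a walk may enter the node by an arrowhead. -/
def expandWalk : Prog :=
  .seq (.assign 9 (.load 7 (.reg 4)))
    (.seq (.assign 9 (.add (.reg 9) (.reg 5)))
      (.seq
        (.ite (.eq (.reg 9) (.const 1))
          (.seq (scan .left (push .tail)) (scan .both (push .head))) .skip)
        (.seq (.assign 9 (.load 7 (.reg 4)))
          (.ite (.eq (.reg 9) (.const 0))
            (.ite (.eq (.reg 4) (.reg 1)) .skip (scan .right (push .head))) .skip))))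

/-- Append the successors of the state with node in register `4` and label in register `5`. -/
def expand : Prog :=
  .ite (.eq (.reg 5) (.const Kind.anc.code)) (scan .left (push .anc))
    (.ite (.eq (.reg 5) (.const Kind.bad.code)) (scan .right (push .bad)) expandWalk)

/-- Process the queue; the number of processed states is in register `2`. -/
def search : Prog :=
  .while (.lt (.reg 2) (.reg 3))
    (.seq (.assign 4 (.load 13 (.reg 2)))
      (.seq (.assign 5 (.load 14 (.reg 2)))
        (.seq (.assign 2 (.add (.reg 2) (.const 1))) expand)))

namespace ADMG

variable {V : Type*} {G : ADMG V} {W : Set V} {x v : V} {s : V × Kind}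

theorem step_anc_iff :
    G.Step W x (v, .anc) s ↔ ∃ u, G.Edge .left v u ∧ s ∈ ({(u, .anc)} : Set _) := by
  constructor
  · rintro h
    cases h with
    | walk hm => simp at hm
    | anc h => exact ⟨_, h, rfl⟩
  · rintro ⟨u, h, rfl⟩
    exact .anc h

theorem step_bad_iff :
    G.Step W x (v, .bad) s ↔ ∃ u, G.Edge .right v u ∧ s ∈ ({(u, .bad)} : Set _) := by
  constructor
  · rintro h
    cases h with
    | walk hm => simp at hm
    | bad h => exact ⟨_, h, rfl⟩
  · rintro ⟨u, h, rfl⟩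
    exact .bad h

theorem step_walk_iff {k : Kind} (hk : k = .head ∨ k = .tail) : G.Step W x (v, k) s ↔
    ((v ∈ W ↔ k = .head) ∧ ((∃ u, G.Edge .left v u ∧ s ∈ ({(u, .tail)} : Set _)) ∨
      ∃ u, G.Edge .both v u ∧ s ∈ ({(u, .head)} : Set _))) ∨
    ((v ∉ W ∧ v ≠ x) ∧ ∃ u, G.Edge .right v u ∧ s ∈ ({(u, .head)} : Set _)) := by
  constructor
  · rintro h
    cases h with
    | anc h => simp at hk
    | bad h => simp at hk
    | @walk t _ w _ hm he hp hx =>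
      cases t with
      | right =>
        refine Or.inl ⟨?_, Or.inl ⟨w, he, rfl⟩⟩
        by_cases h : k = .head <;> simp_all [Pass]
      | both =>
        refine Or.inl ⟨?_, Or.inr ⟨w, SimpleGraph.Adj.symm he, rfl⟩⟩
        by_cases h : k = .head <;> simp_all [Pass]
      | left =>
        exact Or.inr ⟨⟨hp.2 (by simp), fun h => hx ⟨rfl, h⟩⟩, w, he, rfl⟩
  · rintro (⟨h, ⟨u, he, rfl⟩ | ⟨u, he, rfl⟩⟩ | ⟨⟨h, hx⟩, u, he, rfl⟩)
    · exact .walk (s := .right) hk he (by by_cases k = .head <;> simp_all [Pass]) (by simp)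
    · exact .walk (s := .both) hk (SimpleGraph.Adj.symm he)
        (by by_cases k = .head <;> simp_all [Pass]) (by simp)
    · exact .walk (s := .left) hk he (by simp [Pass, h]) (by simp [hx])

end ADMG

variable {p : ℕ} {G : ADMG (Fin p)} {L : AdjLists G} {Z W : Finset (Fin p)} {x : Fin p} {N : ℕ}

/-- With the node `v` in register `4` and the code of `k` in register `5`, the program `P` appends
exactly the elements of `S` to the queue, in time `T`. -/
def Expands (L : AdjLists G) (Z W : Finset (Fin p)) (x : Fin p) (N : ℕ) (v : Fin p) (k : Kind)
    (P : Prog) (T : ℕ) (S : Set (Fin p × Kind)) : Prop :=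
  ∀ σ l, Holds L Z W x σ l → σ.reg 4 = v → σ.reg 5 = k.code →
    Runs N P σ T fun τ => ∃ l', Holds L Z W x τ l' ∧ Extends l l' S ∧
      ∀ r < 6, r ≠ 3 → τ.reg r = σ.reg r

section

variable {v : Fin p} {k : Kind} {P P' : Prog} {T T' : ℕ} {S S' : Set (Fin p × Kind)}

theorem Expands.mono (h : Expands L Z W x N v k P T S) (hT : T ≤ T') (hS : ∀ s, s ∈ S ↔ s ∈ S') :
    Expands L Z W x N v k P T' S' := fun σ l hσ h4 h5 =>
  (h σ l hσ h4 h5).mono hT fun _ ⟨l', hτ, he, hr⟩ => ⟨l', hτ, he.congr hS, hr⟩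

theorem Expands.seq (h : Expands L Z W x N v k P T S) (h' : Expands L Z W x N v k P' T' S') :
    Expands L Z W x N v k (.seq P P') (T + T') (S ∪ S') := by
  intro σ l hσ h4 h5
  refine Runs.seq ((h σ l hσ h4 h5).mono le_rfl ?_)
  rintro τ ⟨l', hτ, he, hr⟩
  refine (h' τ l' hτ ((hr 4 (by decide) (by decide)).trans h4)
    ((hr 5 (by decide) (by decide)).trans h5)).mono le_rfl ?_
  rintro τ' ⟨l'', hτ', he', hr'⟩
  exact ⟨l'', hτ', he.trans he', fun r h1 h2 => (hr' r h1 h2).trans (hr r h1 h2)⟩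

theorem Expands.scan_push (hN : 4 * p + 2 * G.numEdges + 4 ≤ N) (t : EdgeType) (k' : Kind) :
    Expands L Z W x N v k (scan t (push k')) (9 * (L.nbrs t v).length + 4)
      {s | ∃ u, G.Edge t v u ∧ s ∈ ({(u, k')} : Set _)} := by
  intro σ l hσ h4 _
  refine (Runs.scan (C := fun _ => True) (Appends.push hN fun _ _ _ => trivial) hN hσ trivial
    h4).mono le_rfl ?_
  rintro τ ⟨l', hτ, -, he, hr⟩
  exact ⟨l', hτ, he, hr⟩

theorem Expands.expand_walk (hN : 4 * p + 2 * G.numEdges + 4 ≤ N) (hk : k = .head ∨ k = .tail) :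
    Expands L Z W x N v k expandWalk
      (9 * ((L.nbrs .right v).length + (L.nbrs .left v).length + (L.nbrs .both v).length) + 20)
      {s | G.Step W x (v, k) s} := by
  have hcode : k.code = if k = .head then 0 else 1 := by obtain rfl | rfl := hk <;> rfl
  have hright : Expands L Z W x N v k
      (.seq (.assign 9 (.load 7 (.reg 4))) (.ite (.eq (.reg 9) (.const 0))
        (.ite (.eq (.reg 4) (.reg 1)) .skip (scan .right (push .head))) .skip))
      (9 * (L.nbrs .right v).length + 7)
      {s | (v ∉ W ∧ v ≠ x) ∧ ∃ u, G.Edge .right v u ∧ s ∈ ({(u, .head)} : Set _)} := by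
    intro σ l hσ h4 h5
    have hW := hσ.arr_W v
    set σ' := σ.setReg 9 ((Expr.load 7 (.reg 4)).eval σ) with hσ'
    have hH : Holds L Z W x σ' l := hσ.setReg (by decide) (by decide) (by decide)
    have hr9 : ∀ r < 6, σ'.reg r = σ.reg r := fun r hr => by simp [hσ', show r ≠ 9 by omega]
    have h9 : σ'.reg 9 = if v ∈ W then 1 else 0 := by simp [hσ', h4, hW]
    refine Runs.seq_assign (by simp only [eval_load, eval_reg, h4, hW]; split <;> omega)
      (Runs.ite (T := 9 * (L.nbrs .right v).length + 5) (fun hb => ?_) fun hb => ?_)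
    · have hvW : v ∉ W := by intro h; rw [holds_eq, eval_reg, h9, if_pos h] at hb; simp at hb
      refine Runs.ite (T := 9 * (L.nbrs .right v).length + 4) (fun hb => ?_) fun hb => ?_
      · have hvx : v = x := by
          simpa [hr9 4, hr9 1, h4, hσ.reg_one, Fin.val_inj] using hb
        exact (Runs.skip ⟨l, hH, (Extends.refl l).congr (by simp [hvx]),
          fun r h1 _ => hr9 r h1⟩).mono_time (by omega)
      · have hvx : v ≠ x := by
          rintro rfl
          exact hb (((hr9 4 (by omega)).trans h4).trans ((hr9 1 (by omega)).trans hσ.reg_one).symm)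
        refine (Expands.scan_push hN .right .head σ' l hH ((hr9 4 (by omega)).trans h4)
          ((hr9 5 (by omega)).trans h5)).mono le_rfl ?_
        rintro τ ⟨l', hτ, he, hr⟩
        exact ⟨l', hτ, he.congr (by simp [hvW, hvx]), fun r h1 h2 =>
          (hr r h1 h2).trans (hr9 r h1)⟩
    · have hvW : v ∈ W := by
        by_contra h
        rw [holds_eq, eval_reg, h9, if_neg h] at hb
        exact hb rfl
      exact (Runs.skip ⟨l, hH, (Extends.refl l).congr (by simp [hvW]),
          fun r h1 _ => hr9 r h1⟩).mono_time (by omega)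
  intro σ l hσ h4 h5
  have hW := hσ.arr_W v
  set σ₁ := σ.setReg 9 ((Expr.load 7 (.reg 4)).eval σ) with hσ₁
  set σ' := σ₁.setReg 9 ((Expr.add (.reg 9) (.reg 5)).eval σ₁) with hσ'
  have hH : Holds L Z W x σ' l :=
    (hσ.setReg (by decide) (by decide) (by decide)).setReg (by decide) (by decide) (by decide)
  have hr9 : ∀ r < 6, σ'.reg r = σ.reg r := fun r hr => by
    simp [hσ', hσ₁, show r ≠ 9 by omega]
  have h9 : (Expr.add (.reg 9) (.reg 5)).eval σ₁ =
      (if v ∈ W then 1 else 0) + if k = .head then 0 else 1 := by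
    simp [hσ₁, h4, h5, hW, hcode]
  have hleft : Runs N (.ite (.eq (.reg 9) (.const 1))
      (.seq (scan .left (push .tail)) (scan .both (push .head))) .skip) σ'
      ((9 * (L.nbrs .left v).length + 4 + (9 * (L.nbrs .both v).length + 4)) + 1)
      fun τ => ∃ l', Holds L Z W x τ l' ∧
        Extends l l' {s | (v ∈ W ↔ k = .head) ∧
          ((∃ u, G.Edge .left v u ∧ s ∈ ({(u, .tail)} : Set _)) ∨
            ∃ u, G.Edge .both v u ∧ s ∈ ({(u, .head)} : Set _))} ∧
        ∀ r < 6, r ≠ 3 → τ.reg r = σ'.reg r := by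
    have h9' : σ'.reg 9 = (if v ∈ W then 1 else 0) + if k = .head then 0 else 1 := by
      simp only [hσ', setReg_reg, h9, if_true]
    refine Runs.ite (fun hb => ?_) fun hb => ?_
    · have hvk : v ∈ W ↔ k = .head := by
        rw [holds_eq, eval_reg, h9'] at hb
        by_cases h1 : v ∈ W <;> by_cases h2 : k = .head <;> simp_all
      refine ((Expands.scan_push hN .left .tail).seq (Expands.scan_push hN .both .head) σ' l hH
        ((hr9 4 (by omega)).trans h4) ((hr9 5 (by omega)).trans h5)).mono le_rfl ?_
      rintro τ ⟨l', hτ, he, hr⟩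
      exact ⟨l', hτ, he.congr fun s => ⟨fun h => ⟨hvk, h⟩, fun h => h.2⟩, hr⟩
    · have hvk : ¬ (v ∈ W ↔ k = .head) := by
        rw [holds_eq, eval_reg, h9'] at hb
        by_cases h1 : v ∈ W <;> by_cases h2 : k = .head <;> simp_all
      exact (Runs.skip ⟨l, hH, (Extends.refl l).congr (by simp [hvk]),
        fun r _ _ => rfl⟩).mono_time (by omega)
  refine (Runs.seq_assign (by simp only [eval_load, eval_reg, h4, hW]; split <;> omega)
    (Runs.seq_assign (by rw [h9]; split <;> split <;> omega)
      (Runs.seq (T' := 9 * (L.nbrs .right v).length + 7) (hleft.mono le_rfl ?_)))).mono_time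
    (by omega)
  rintro τ ⟨l', hτ, he, hr⟩
  refine (hright τ l' hτ (((hr 4 (by decide) (by decide)).trans (hr9 4 (by decide))).trans h4)
    (((hr 5 (by decide) (by decide)).trans (hr9 5 (by decide))).trans h5)).mono le_rfl ?_
  rintro τ' ⟨l'', hτ', he', hr'⟩
  exact ⟨l'', hτ', (he.trans he').congr fun s => (ADMG.step_walk_iff hk).symm, fun r h1 h2 =>
    ((hr' r h1 h2).trans (hr r h1 h2)).trans (hr9 r h1)⟩

/-- An upper bound for the time in which a state with the node `v` is taken from the queue and
processed. -/
def cost (L : AdjLists G) (v : Fin p) : ℕ :=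
  9 * ((L.nbrs .right v).length + (L.nbrs .left v).length + (L.nbrs .both v).length) + 26

theorem Expands.expand (hN : 4 * p + 2 * G.numEdges + 4 ≤ N) :
    Expands L Z W x N v k expand
      (9 * ((L.nbrs .right v).length + (L.nbrs .left v).length + (L.nbrs .both v).length) + 22)
      {s | G.Step W x (v, k) s} := by
  intro σ l hσ h4 h5
  have hcode : ∀ k', (Test.eq (.reg 5) (.const k'.code)).Holds σ ↔ k = k' := by
    intro k'
    rw [holds_eq, eval_reg, h5, eval_const]
    cases k <;> cases k' <;> decide
  refine Runs.ite (fun hb => ?_) fun hb => Runs.ite (fun hb' => ?_) fun hb' => ?_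
  · obtain rfl := (hcode _).1 hb
    exact ((Expands.scan_push hN .left .anc).mono (by omega) fun s => ADMG.step_anc_iff.symm)
      σ l hσ h4 h5
  · obtain rfl := (hcode _).1 hb'
    exact ((Expands.scan_push hN .right .bad).mono (by omega) fun s => ADMG.step_bad_iff.symm)
      σ l hσ h4 h5
  · rw [hcode] at hb hb'
    exact Expands.expand_walk hN (by cases k <;> simp_all) σ l hσ h4 h5

end

/-- The states that are not among the first `h` entries of the queue still have to be paid for. -/
def remaining (L : AdjLists G) (l : List (Fin p × Kind)) (h : ℕ) : ℕ :=
  ∑ s ∈ Finset.univ \ (l.take h).toFinset, cost L s.1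

theorem remaining_succ {l : List (Fin p × Kind)} (hl : l.Nodup) {h : ℕ} (hh : h < l.length) :
    remaining L l h = cost L l[h].1 + remaining L l (h + 1) := by
  have hmem : l[h] ∉ l.take h := by
    intro hm
    obtain ⟨i, hi, he⟩ := List.mem_take_iff_getElem.1 hm
    have := (hl.getElem_inj_iff).1 he
    omega
  have htake : (l.take (h + 1)).toFinset = insert l[h] (l.take h).toFinset := by
    ext s
    rw [← List.take_append_getElem hh]
    simp only [List.mem_toFinset, Finset.mem_insert, List.mem_append, List.mem_singleton, or_comm]
  rw [remaining, remaining, htake, Finset.sdiff_insert, 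
    Finset.add_sum_erase _ (fun s : Fin p × Kind => cost L s.1)]
  simpa using hmem

theorem remaining_le (l : List (Fin p × Kind)) (h : ℕ) :
    remaining L l h ≤ 216 * G.numEdges + 104 * p := by
  have h1 : remaining L l h ≤ ∑ s : Fin p × Kind, cost L s.1 :=
    Finset.sum_le_sum_of_subset (Finset.subset_univ _)
  have h2 : ∑ s : Fin p × Kind, cost L s.1 = 4 * ∑ v, cost L v := by
    rw [Fintype.sum_prod_type, Finset.mul_sum]
    exact Finset.sum_congr rfl fun v _ => by
      show ∑ _k : Kind, cost L v = _
      rw [Finset.sum_const]; rfl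
  have h3 : ∑ v, cost L v = 9 * (∑ v, (L.nbrs .right v).length + ∑ v, (L.nbrs .left v).length +
      ∑ v, (L.nbrs .both v).length) + 26 * p := by
    simp only [cost, Finset.sum_add_distrib, ← Finset.mul_sum]
    simp [mul_comm]
  have := L.sum_length_le .right
  have := L.sum_length_le .left
  have := L.sum_length_le .both
  omega

/-- The search completes a partially processed queue to the set of all reachable states. -/
theorem Runs.search (hN : 4 * p + 2 * G.numEdges + 4 ≤ N) {S : Set (Fin p × Kind)} {σ : Store}
    {l : List (Fin p × Kind)} {h : ℕ} (hσ : Holds L Z W x σ l) (h2 : σ.reg 2 = h)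
    (hh : h ≤ l.length) (hS : S ⊆ {s | s ∈ l}) (hR : ∀ s ∈ l, s ∈ G.Reach W x S)
    (hcl : ∀ s ∈ l.take h, ∀ s', G.Step W x s s' → s' ∈ l) :
    Runs N search σ (216 * G.numEdges + 104 * p + 1) fun τ =>
      ∃ l', Holds L Z W x τ l' ∧ τ.reg 2 = l'.length ∧ (∀ s, s ∈ l' ↔ s ∈ G.Reach W x S) := by
  let I : ℕ → Store → Prop := fun n τ => ∃ l h, Holds L Z W x τ l ∧ τ.reg 2 = h ∧ h ≤ l.length ∧
    S ⊆ {s | s ∈ l} ∧ (∀ s ∈ l, s ∈ G.Reach W x S) ∧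
    (∀ s ∈ l.take h, ∀ s', G.Step W x s s' → s' ∈ l) ∧ n = remaining L l h
  have hI : ∀ n τ, I n τ → (Test.lt (.reg 2) (.reg 3)).Holds τ → ∃ T n', T + 1 + n' ≤ n ∧
      Runs N (.seq (.assign 4 (.load 13 (.reg 2)))
        (.seq (.assign 5 (.load 14 (.reg 2)))
          (.seq (.assign 2 (.add (.reg 2) (.const 1))) expand))) τ T (I n') := by
    rintro n τ ⟨l, h, hτ, h2, hh, hS, hR, hcl, rfl⟩ hb
    have hlt : h < l.length := by simpa [h2, hτ.length] using hb
    have hle := hτ.length_le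
    have hnode := hτ.node h hlt
    have hkind := hτ.kind h hlt
    have hv := l[h].1.2
    have hk : l[h].2.code ≤ 3 := by cases l[h].2 <;> decide
    refine ⟨_, remaining L l (h + 1), ?_, (Runs.seq_assign (by simp [h2, hnode]; omega)
      (Runs.seq_assign (by simp [h2, hkind]; omega) (Runs.seq_assign (by simp [h2]; omega)
        ((Expands.expand (v := l[h].1) (k := l[h].2) hN _ l (((hτ.setReg (by decide) (by decide)
          (by decide)).setReg (by decide) (by decide) (by decide)).setReg (by decide) (by decide)
          (by decide)) ?_ ?_).mono le_rfl ?_))))⟩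
    · rw [remaining_succ hτ.nodup hlt, cost]
    · simp [h2, hnode]
    · simp [h2, hkind]
    rintro τ' ⟨l', hτ', ⟨hpre, hmem⟩, hr⟩
    have htake : l'.take (h + 1) = l.take (h + 1) := by
      obtain ⟨a, rfl⟩ := hpre
      exact List.take_append_of_le_length hlt
    refine ⟨l', h + 1, hτ', ?_, Nat.le_trans hlt hpre.length_le, ?_, ?_, ?_, ?_⟩
    · rw [hr 2 (by decide) (by decide)]; simp [h2]
    · exact fun s hs => hpre.subset (hS hs)
    · intro s hs
      obtain hs | hs := (hmem s).1 hs
      · exact hR s hs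
      · exact ADMG.Reach.step (hR l[h] (List.getElem_mem hlt)) hs
    · intro s hs s' hst
      rw [htake, ← List.take_append_getElem hlt, List.mem_append, List.mem_singleton] at hs
      obtain hs | rfl := hs
      · exact hpre.subset (hcl s hs s' hst)
      · exact (hmem s').2 (Or.inr hst)
    · simp only [remaining, htake]
  refine (Runs.while_loop I hI _ σ ⟨l, h, hσ, h2, hh, hS, hR, hcl, rfl⟩).mono
    (Nat.succ_le_succ (remaining_le _ _)) ?_
  rintro τ ⟨hb, -, l', h', hτ, h2', hh', hS', hR', hcl', -⟩
  have hlen : h' = l'.length := by simp [h2', hτ.length] at hb; omega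
  subst hlen
  refine ⟨l', hτ, h2', fun s => ⟨hR' s, fun hs => ?_⟩⟩
  rw [List.take_length] at hcl'
  exact ADMG.Reach.subset_of_closed (I := {s | s ∈ l'}) hS'
    (fun s s' hs => hcl' s hs s') hs

end CIS

/-! ### The program -/

namespace CIS

/-- Run `P` if the cell of the array `A` for the node in register `8` is `0`. -/
def unlessMarked (A : ℕ) (P : Prog) : Prog :=
  .seq (.assign 9 (.load A (.reg 8))) (.ite (.eq (.reg 9) (.const 0)) P .skip)

/-- Start the queue with the nodes of `Z` and `W`. -/
def addSeeds : Prog :=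
  forNodes (.seq (ifMarked 6 (.seq (push .anc) (push .tail))) (ifMarked 7 (push .anc)))

/-- Append the children of `x` with label `anc` to the queue. -/
def addLateSeeds : Prog :=
  .seq (.assign 4 (.copy (.reg 1)))
    (scan .right (ifMarked Kind.anc.marks (.seq (push .bad) (push .head))))

/-- Output the nodes outside `W` that have no label, except possibly `anc`. -/
def writeOutput : Prog :=
  forNodes (unlessMarked Kind.head.marks (unlessMarked Kind.tail.marks
    (unlessMarked Kind.bad.marks (unlessMarked 7 (.store outArr (.reg 8) (.const 1))))))

/-- The program that finds all `y` such that `(Z, W)` is a valid conditional instrumental set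
relative to `(x, y)`. -/
def validTargets : Prog :=
  .seq addSeeds (.seq search
    (.seq (.assign 9 (.load Kind.head.marks (.reg 1)))
      (.seq (.assign 4 (.load Kind.tail.marks (.reg 1)))
        (.seq (.assign 9 (.add (.reg 9) (.reg 4)))
          (.ite (.eq (.reg 9) (.const 0)) .skip
            (.seq addLateSeeds (.seq search writeOutput)))))))

variable {p : ℕ} {G : ADMG (Fin p)} {L : AdjLists G} {Z W : Finset (Fin p)} {x : Fin p} {N : ℕ}
  {σ : Store} {l : List (Fin p × Kind)}

theorem holds_initStore : Holds L Z W x (initStore L Z W x) [] where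
  reg_zero := rfl
  reg_one := rfl
  input _ _ := rfl
  output _ := rfl
  mark k v := by cases k <;> rfl
  node _ h := by simp at h
  kind _ h := by simp at h
  length := rfl
  nodup := List.nodup_nil

theorem Runs.addSeeds (hN : 4 * p + 2 * G.numEdges + 4 ≤ N) (hσ : Holds L Z W x σ l) :
    Runs N addSeeds σ (24 * p + 2) fun τ => ∃ l', Holds L Z W x τ l' ∧
      Extends l l' (ADMG.seeds (Z : Set (Fin p)) W) ∧ τ.reg 2 = σ.reg 2 := by
  have hA : Appends L Z W x N (fun _ => True) _ _ _ :=
    (Appends.ifMarked (A := 6) (B := (· ∈ Z)) (by omega) (by omega)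
      (fun σ l hσ _ u => by rw [hσ.arr_Z]; split <;> simp_all)
      ((Appends.push (k := .anc) hN fun _ _ _ => trivial).seq
        (Appends.push (k := .tail) hN fun _ _ _ => trivial))).seq
    (Appends.ifMarked (A := 7) (B := (· ∈ W)) (by omega) (by omega)
      (fun σ l hσ _ u => by rw [hσ.arr_W]; split <;> simp_all)
      (Appends.push (k := .anc) hN fun _ _ _ => trivial))
  refine (Runs.forNodes_appends hA (by omega) hσ trivial).mono le_rfl ?_
  rintro τ ⟨l', hτ, -, he, hr⟩
  refine ⟨l', hτ, he.congr ?_, hr 2 (by decide) (by decide)⟩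
  rintro ⟨u, k⟩
  cases k <;> simp [ADMG.seeds, ← or_and_right]

theorem Runs.addLateSeeds (hN : 4 * p + 2 * G.numEdges + 4 ≤ N) (hσ : Holds L Z W x σ l)
    (hl : ∀ s, s ∈ l ↔ s ∈ G.Reach (W : Set (Fin p)) x (ADMG.seeds (Z : Set (Fin p)) W)) :
    Runs N addLateSeeds σ (34 * G.numEdges + 5) fun τ => ∃ l', Holds L Z W x τ l' ∧
      Extends l l' (G.lateSeeds (Z : Set (Fin p)) W x) ∧ τ.reg 2 = σ.reg 2 := by
  let C : List (Fin p × Kind) → Prop := fun l => ∀ u, (u, Kind.anc) ∈ l ↔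
    (u, Kind.anc) ∈ G.Reach (W : Set (Fin p)) x (ADMG.seeds (Z : Set (Fin p)) W)
  have hA : Appends L Z W x N C _ _ _ :=
    Appends.ifMarked (A := Kind.anc.marks) (B := fun u => (u, Kind.anc) ∈
        G.Reach (W : Set (Fin p)) x (ADMG.seeds (Z : Set (Fin p)) W)) (by omega) (by omega)
      (fun σ l hσ hC u => by rw [hσ.mark, ← hC u]; split <;> simp_all)
      ((Appends.push (k := .bad) hN fun l u hC v => by simp [hC v]).seq
        (Appends.push (k := .head) hN fun l u hC v => by simp [hC v]))
  have hlen : (L.nbrs .right x).length ≤ 2 * G.numEdges :=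
    (Finset.single_le_sum (f := fun v => (L.nbrs .right v).length) (fun _ _ => Nat.zero_le _)
      (Finset.mem_univ x)).trans (L.sum_length_le .right)
  have hx := x.2
  refine (Runs.seq_assign (by simp [hσ.reg_one]; omega) ((Runs.scan hA hN (v := x)
    (hσ.setReg (by decide) (by decide) (by decide)) (fun u => hl _)
    (by simp [hσ.reg_one])).mono le_rfl ?_)).mono_time (by omega)
  rintro τ ⟨l', hτ, -, he, hr⟩
  refine ⟨l', hτ, he.congr ?_, (hr 2 (by decide) (by decide)).trans (by simp)⟩
  rintro ⟨u, k⟩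
  cases k <;> simp [ADMG.lateSeeds, ADMG.Edge]

theorem Runs.unlessMarked {A u T : ℕ} {P : Prog} {Q : Store → Prop} (h8 : σ.reg 8 = u)
    (hN : σ.arr A u ≤ N) (hT : 1 ≤ T)
    (h : σ.arr A u = 0 → Runs N P (σ.setReg 9 (σ.arr A u)) T Q)
    (h' : σ.arr A u ≠ 0 → Q (σ.setReg 9 (σ.arr A u))) :
    Runs N (unlessMarked A P) σ (T + 2) Q := by
  have he : (Expr.load A (.reg 8)).eval σ = σ.arr A u := by simp [h8]
  refine Runs.seq_assign (by rwa [he]) ?_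
  rw [he]
  refine Runs.ite (fun hb => h ?_) fun hb => (Runs.skip (h' ?_)).mono_time hT
  · simpa using hb
  · simpa using hb

theorem Runs.writeOutput (hN : 4 * p + 2 * G.numEdges + 4 ≤ N) (hσ : Holds L Z W x σ l) :
    Runs N writeOutput σ (11 * p + 2) fun τ =>
      Outputs τ {y : Fin p | y ∉ W ∧ ∀ k, k ≠ .anc → (y, k) ∉ l} := by
  classical
  set R : Set (Fin p) := {y : Fin p | y ∉ W ∧ ∀ k, k ≠ .anc → (y, k) ∉ l}
  let J : ℕ → Store → Prop := fun j τ => τ.reg 0 = p ∧ (∀ A, A ≠ outArr → τ.arr A = σ.arr A) ∧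
    ∀ v : Fin p, τ.arr outArr v = if (v : ℕ) < j ∧ v ∈ R then 1 else 0
  refine (Runs.forNodes J (by omega) (fun _ _ h => h.1) ?_ ?_ ?_).mono le_rfl ?_
  · rintro j τ k ⟨h0, hA, hv⟩
    exact ⟨by simp [h0], hA, hv⟩
  · rintro j hj τ ⟨h0, hA, hout⟩ h8
    set u : Fin p := ⟨j, hj⟩ with hu
    have hstep : ∀ v : Fin p, (v : ℕ) < j + 1 ↔ (v : ℕ) < j ∨ v = u := by
      intro v
      rw [Nat.lt_succ_iff_lt_or_eq, Fin.ext_iff]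
    have hskip : u ∉ R → ∀ τ' : Store, τ'.arr = τ.arr → τ'.reg 0 = τ.reg 0 →
        τ'.reg 8 = τ.reg 8 → J (j + 1) τ' ∧ τ'.reg 8 = j := by
      intro huR τ' ha hr0 hr8
      refine ⟨⟨hr0.trans h0, by rw [ha]; exact hA, fun v => ?_⟩, hr8.trans h8⟩
      simp only [ha, hout, hstep]
      by_cases hvu : v = u
      · subst hvu; simp [huR]
      · simp [hvu]
    have hmark : ∀ k : Kind, τ.arr k.marks j = if (u, k) ∈ l then 1 else 0 := by
      intro k
      rw [hA _ (by cases k <;> decide)]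
      exact hσ.mark k u
    have hW : τ.arr 7 j = if u ∈ W then 1 else 0 := by
      rw [hA _ (by decide)]
      exact hσ.arr_W u
    have hle : ∀ k : Kind, τ.arr k.marks j ≤ N := fun k => by rw [hmark]; split <;> omega
    refine Runs.unlessMarked (u := j) (T := 7) (by simp [h8]) (hle .head) (by omega)
      (fun h1 => ?_) fun h1 => hskip
        (fun h => h1 ((hmark .head).trans (if_neg (h.2 .head (by decide)))))
        _ rfl (by simp) (by simp)
    refine Runs.unlessMarked (u := j) (T := 5) (by simp [h8]) (hle .tail) (by omega)
      (fun h2 => ?_) fun h2 => hskip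
        (fun h => h2 ((hmark .tail).trans (if_neg (h.2 .tail (by decide)))))
        _ rfl (by simp) (by simp)
    refine Runs.unlessMarked (u := j) (T := 3) (by simp [h8]) (hle .bad) (by omega)
      (fun h3 => ?_) fun h3 => hskip
        (fun h => h3 ((hmark .bad).trans (if_neg (h.2 .bad (by decide)))))
        _ rfl (by simp) (by simp)
    refine Runs.unlessMarked (u := j) (T := 1) (by simp [h8])
      (by simp only [setReg_arr, hW]; split <;> omega) le_rfl
      (fun h4 => ?_) fun h4 => hskip (fun h => h4 (hW.trans (if_neg h.1)))
        _ rfl (by simp) (by simp)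
    have huR : u ∈ R := by
      refine ⟨fun h => ?_, fun k hk h => ?_⟩
      · rw [if_pos h] at hW
        exact one_ne_zero (hW.symm.trans h4)
      · have hk' := hmark k
        rw [if_pos h] at hk'
        refine one_ne_zero (hk'.symm.trans ?_)
        cases k
        exacts [h1, h2, absurd rfl hk, h3]
    refine Runs.store (by simp [h8]; omega) (by simp; omega) ⟨⟨by simp [h0], ?_, ?_⟩, by simp [h8]⟩
    · intro A hA'
      funext i
      simp [hA', hA A hA']
    · intro v
      simp only [hstep]
      by_cases hvu : v = u
      · rw [hvu]; simp [huR, h8, show (u : ℕ) = j from rfl]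
      · have : (v : ℕ) ≠ j := fun h => hvu (Fin.ext h)
        simp [hvu, this, h8, hout]
  · exact ⟨hσ.reg_zero, fun _ _ => rfl, fun v => by simp [hσ.output]⟩
  · rintro τ ⟨-, -, h⟩ y
    rw [h y]
    exact ⟨fun hy => by simp [hy], fun hy => by simp [hy]⟩

theorem Runs.validTargets (hN : 4 * p + 2 * G.numEdges + 4 ≤ N) (hxZ : x ∉ Z) (hZW : Disjoint Z W)
    (hxW : x ∉ W) :
    Runs N validTargets (initStore L Z W x) (500 * G.numEdges + 300 * p + 20) fun τ =>
      Outputs τ {y : Fin p | G.IsValidCIS (Z : Set (Fin p)) (W : Set (Fin p)) x y} := by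
  have hvalid := ADMG.isValidCIS_iff (G := G) (Z := (Z : Set (Fin p))) (W := (W : Set (Fin p)))
    (x := x) (by simpa using hxZ) (by simpa using hZW) (by simpa using hxW)
  refine (Runs.seq (T' := 500 * G.numEdges + 276 * p + 18)
    ((Runs.addSeeds hN holds_initStore).mono le_rfl ?_)).mono_time (by omega)
  rintro σ₁ ⟨l₁, h₁, he₁, hr₁⟩
  have hl₁ : ∀ s, s ∈ l₁ ↔ s ∈ ADMG.seeds (Z : Set (Fin p)) (W : Set (Fin p)) :=
    fun s => by simp [he₁.2]
  refine (Runs.seq (T' := 250 * G.numEdges + 115 * p + 15) ((Runs.search hN h₁ (h := 0) hr₁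
    (Nat.zero_le _) (fun s => (hl₁ s).2) (fun s hs => ADMG.Reach.of_mem ((hl₁ s).1 hs))
    (by simp)).mono le_rfl ?_)).mono_time (by omega)
  rintro σ₂ ⟨l₂, h₂, hr₂, hl₂⟩
  have hm := h₂.mark_le .head x
  have hm' := h₂.mark_le .tail x
  set a := σ₂.arr Kind.head.marks x with ha
  set b := σ₂.arr Kind.tail.marks x with hb
  refine (Runs.seq_assign (T := 250 * G.numEdges + 115 * p + 14) (by simp [h₂.reg_one]; omega)
    (Runs.seq_assign (T := 250 * G.numEdges + 115 * p + 13) (by simp [h₂.reg_one]; omega)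
    (Runs.seq_assign (T := 250 * G.numEdges + 115 * p + 12) (by simp [h₂.reg_one]; omega) ?_)))
  set σ₃ := Store.setReg _ 9 _ with hσ₃
  have h₃ : Holds L Z W x σ₃ l₂ := ((h₂.setReg (by decide) (by decide) (by decide)).setReg
    (by decide) (by decide) (by decide)).setReg (by decide) (by decide) (by decide)
  have h9 : σ₃.reg 9 = a + b := by simp [hσ₃, h₂.reg_one, ha, hb]
  have h2 : σ₃.reg 2 = l₂.length := by simp [hσ₃, hr₂]
  have hx : a + b ≠ 0 ↔ ∃ m, (m = Kind.head ∨ m = .tail) ∧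
      (x, m) ∈ G.Reach (W : Set (Fin p)) x (ADMG.seeds (Z : Set (Fin p)) W) := by
    simp [ha, hb, h₂.mark, ← hl₂, or_and_right, exists_or, ← or_iff_not_imp_left]
  refine Runs.ite (T := 250 * G.numEdges + 115 * p + 11) (fun hb => ?_) fun hb => ?_
  · refine (Runs.skip fun y => ⟨fun hy => ?_, fun _ => h₃.output y⟩).mono_time (by omega)
    rw [holds_eq, eval_reg, h9] at hb
    exact absurd hb (hx.2 ((hvalid y).1 hy).1)
  · have hx := hx.1 (by rw [holds_eq, eval_reg, h9] at hb; exact hb)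
    refine (Runs.seq (T' := 216 * G.numEdges + 115 * p + 6)
      ((Runs.addLateSeeds hN h₃ hl₂).mono le_rfl ?_)).mono_time (by omega)
    rintro σ₄ ⟨l₄, h₄, he₄, hr₄⟩
    refine (Runs.seq (T' := 11 * p + 2) ((Runs.search hN h₄ (h := l₂.length)
      (S := ADMG.seeds (Z : Set (Fin p)) W ∪ G.lateSeeds (Z : Set (Fin p)) W x)
      (hr₄.trans h2) he₄.1.length_le ?_ ?_ ?_).mono le_rfl ?_)).mono_time (by omega)
    · rintro s (hs | hs)
      · exact (he₄.2 s).2 (Or.inl ((hl₂ s).2 (ADMG.Reach.of_mem hs)))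
      · exact (he₄.2 s).2 (Or.inr hs)
    · intro s hs
      obtain hs | hs := (he₄.2 s).1 hs
      · exact ADMG.Reach.mono Set.subset_union_left ((hl₂ s).1 hs)
      · exact ADMG.Reach.of_mem (Or.inr hs)
    · -- The first search has already processed its part of the queue.
      intro s hs s' hst
      obtain ⟨a, rfl⟩ := he₄.1
      rw [List.take_left] at hs
      exact List.mem_append_left _ ((hl₂ s').2 (ADMG.Reach.step ((hl₂ s).1 hs) hst))
    · rintro σ₅ ⟨l₅, h₅, -, hl₅⟩
      refine (Runs.writeOutput hN h₅).mono le_rfl fun τ hτ => ?_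
      convert hτ using 2
      ext y
      simp only [hvalid y, hl₅]
      exact ⟨fun h => ⟨by simpa using h.2.1, h.2.2⟩, fun h => ⟨hx, by simpa using h.1, h.2⟩⟩

end CIS

theorem mainTheorem3 :
    ∃ (P : CIS.Prog) (c : ℕ),
      ∀ (p : ℕ) (G : CIS.ADMG (Fin p)) (L : CIS.AdjLists G)
        (Z W : Finset (Fin p)) (x : Fin p),
        Disjoint Z {x} → Disjoint Z W → Disjoint {x} W →
          ∃ (t : ℕ) (σ : CIS.Store),
            CIS.Exec (c * (p + G.numEdges)) P (CIS.initStore L Z W x) t σ ∧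
              t ≤ c * (p + G.numEdges) ∧
              CIS.Outputs σ {y : Fin p | G.IsValidCIS (Z : Set (Fin p)) (W : Set (Fin p)) x y} := by
  -- The additive constant in the bound of `Runs.validTargets` is absorbed because `1 ≤ p`.
  refine ⟨CIS.validTargets, 500, fun p G L Z W x hxZ hZW hxW => ?_⟩
  have hp := x.pos
  exact (CIS.Runs.validTargets (by omega) (by simpa using hxZ) hZW (by simpa using hxW)).mono_time
    (by omega)
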